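/- **Notation.** Let $q\ge 1$ be an integer, $\alpha\in\mathbb R$, and write $A^\dagger$ for the Moore–Penrose inverse of a complex matrix $A$. All sequences $(s_j)_{j=0}^{\kappa}$, $\kappa\in\{0,1,2,\dots\}\cup\{\infty\}$, consist of complex $q\times q$ matrices. Put $H_n=[s_{j+k}]_{j,k=0}^{n}$ (a block Hankel matrix, defined when $2n\le\kappa$) and, if $\kappa\ge1$, let $v_j=-\alpha s_j+s_{j+1}$ for $0\le j\le\kappa-1$, with block Hankel matrices $H_n^{(\alpha)}=[v_{j+k}]_{j,k=0}^{n}$ (defined when $2n+1\le\kappa$). Put $$L_0=s_0,\qquad L_n=s_{2n}-[s_n,\dots,s_{2n-1}]\,H_{n-1}^\dagger\begin{bmatrix}s_n\\ \vdots\\ s_{2n-1}\end{bmatrix}\quad(n\ge1,\ 2n\le\kappa),$$ and let $L_n^{(\alpha)}$ (defined when $2n+1\le\kappa$) be the matrix built in the same way from $(v_j)_{j=0}^{\kappa-1}$. **Classes.** * $K^{\ge}_m$ for finite $m\geq 0$: $(s_j)_{j=0}^m\in K^{\ge}_m$ iff $H_{\lfloor m/2\rfloor}$ and, if $m\ge1$,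 also $H^{(\alpha)}_{\lfloor (m-1)/2\rfloor}$ are nonnegative Hermitian. $K^{\ge}_\infty$ is the set of all infinite sequences with $(s_j)_{j=0}^m\in K^{\ge}_m$ for all $m$. * $K^{>}_\kappa$: defined in the same way, with "positive definite Hermitian" in place of "nonnegative Hermitian". * $K^{\ge,e}_m$ for finite $m$: the set of all $(s_j)_{j=0}^m$ for which there is a matrix $s_{m+1}$ with $(s_j)_{j=0}^{m+1}\in K^{\ge}_{m+1}$; and $K^{\ge,e}_\infty=K^{\ge}_\infty$. * $K^{\ge,cd}_{2n}=\{(s_j)_{j=0}^{2n}\in K^{\ge}_{2n}: L_n=0\}$ and $K^{\ge,cd}_{2n+1}=\{(s_j)_{j=0}^{2n+1}\in K^{\ge}_{2n+1}: L^{(\alpha)}_n=0\}$ for $n\ge0$; $K^{\ge,cd}_\infty$ is the set of all $(s_j)_{j=0}^\infty\in K^{\ge}_\infty$ such that $(s_j)_{j=0}^m\in K^{\ge,cd}_m$ for some finite $m\geq 0$. * $K^{\ge,cd_m}_\kappa=\{(s_j)_{j=0}^\kappa\in K^{\ge}_\kappa: (s_j)_{j=0}^m\in K^{\ge,cd}_m\}$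 for integers $0\le m\le\kappa$. **Transform.** Let $\kappa\ge1$. Put $u_0=s_0$ and $u_j=-\alpha s_{j-1}+s_j$ for $1\le j\le\kappa$. Let $u_0^\sharp=u_0^\dagger$ and $u_j^\sharp=-u_0^\dagger\sum_{l=0}^{j-1}u_{j-l}u_l^\sharp$ for $1\le j\le\kappa$. The first $\alpha$-Schur–Stieltjes transform of $(s_j)_{j=0}^\kappa$ is the sequence $$s_j^{[1,\alpha]}=-\,s_0\,u_{j+1}^\sharp\,s_0\qquad(0\le j\le\kappa-1),$$ where $\infty-1=\infty$. **Theorem P1546.** Let $\alpha\in\mathbb R$, let $\kappa\in\{1,2,\dots\}\cup\{\infty\}$, and let $(s_j)_{j=0}^\kappa$ be a sequence of complex $q\times q$ matrices. Then: 1. If $(s_j)_{j=0}^\kappa\in K^{\ge}_\kappa$, then $(s_j^{[1,\alpha]})_{j=0}^{\kappa-1}\in K^{\ge}_{\kappa-1}$. 2. If $(s_j)_{j=0}^\kappa\in K^{\ge,e}_\kappa$, then $(s_j^{[1,\alpha]})_{j=0}^{\kappa-1}\in K^{\ge,e}_{\kappa-1}$. 3. If $(s_j)_{j=0}^\kappa\in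 K^{>}_\kappa$, then $(s_j^{[1,\alpha]})_{j=0}^{\kappa-1}\in K^{>}_{\kappa-1}$. 4. If $m$ is an integer with $0\le m\le\kappa$ and $(s_j)_{j=0}^\kappa\in K^{\ge,cd_m}_\kappa$, then $(s_j^{[1,\alpha]})_{j=0}^{\kappa-1}\in K^{\ge,cd_{\max\{0,m-1\}}}_{\kappa-1}$. 5. If $(s_j)_{j=0}^\kappa\in K^{\ge,cd}_\kappa$, then $(s_j^{[1,\alpha]})_{j=0}^{\kappa-1}\in K^{\ge,cd}_{\kappa-1}$. -/

import Mathlib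

namespace StieltjesSeq

section MoorePenrose

open Matrix
open scoped ComplexOrder

variable {m n : Type*} [Fintype m] [Fintype n]

/-- The four Penrose equations: `B` is the Moore-Penrose inverse of the complex matrix `A`. -/
structure IsMoorePenrose (A : Matrix m n ℂ) (B : Matrix n m ℂ) : Prop where
  mul_mul_self : A * B * A = A
  self_mul_mul : B * A * B = B
  isHermitian_left : (A * B).IsHermitian
  isHermitian_right : (B * A).IsHermitian

theorem IsMoorePenrose.unique {A : Matrix m n ℂ} {B C : Matrix n m ℂ}
    (hB : IsMoorePenrose A B) (hC : IsMoorePenrose A C) : B = C := by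
  have h1 : A * B = A * C := by
    have e : A * C * (A * B) = A * B := by
      rw [← Matrix.mul_assoc, hC.mul_mul_self]
    have e' : A * B * (A * C) = A * C := by
      rw [← Matrix.mul_assoc, hB.mul_mul_self]
    have := congrArg conjTranspose e
    rw [conjTranspose_mul, hB.isHermitian_left, hC.isHermitian_left, e'] at this
    exact this.symm
  have h2 : B * A = C * A := by
    have e : B * A * (C * A) = B * A := by
      rw [Matrix.mul_assoc, ← Matrix.mul_assoc A, hC.mul_mul_self]
    have e' : C * A * (B * A) = C * A := by
      rw [Matrix.mul_assoc, ← Matrix.mul_assoc A, hB.mul_mul_self]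
    have := congrArg conjTranspose e
    rw [conjTranspose_mul, hB.isHermitian_right, hC.isHermitian_right, e'] at this
    exact this.symm
  calc B = B * A * B := hB.self_mul_mul.symm
    _ = C * A * C := by rw [h2, Matrix.mul_assoc, h1, ← Matrix.mul_assoc]
    _ = C := hC.self_mul_mul

theorem exists_hermitian_generalizedInverse [DecidableEq n] {G : Matrix n n ℂ}
    (hG : G.IsHermitian) :
    ∃ X : Matrix n n ℂ, G * X * G = G ∧ X * G * X = X ∧ Xᴴ = X ∧ G * X = X * G := by
  let U : Matrix n n ℂ := hG.eigenvectorUnitary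
  let d : n → ℂ := fun i => (hG.eigenvalues i : ℂ)
  have hU : star U * U = 1 := Unitary.coe_star_mul_self hG.eigenvectorUnitary
  have hGU : G = U * diagonal d * star U := by
    have h := hG.spectral_theorem
    rw [Unitary.conjStarAlgAut_apply] at h
    exact h
  have key : ∀ v w : n → ℂ, (U * diagonal v * star U) * (U * diagonal w * star U) =
      U * diagonal (fun i => v i * w i) * star U := by
    intro v w
    calc (U * diagonal v * star U) * (U * diagonal w * star U)
        = U * diagonal v * (star U * U) * diagonal w * star U := by
          simp only [Matrix.mul_assoc]
      _ = U * diagonal (fun i => v i * w i) * star U := by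
          rw [hU, Matrix.mul_one, Matrix.mul_assoc U, diagonal_mul_diagonal]
  refine ⟨U * diagonal (fun i => (d i)⁻¹) * star U, ?_, ?_, ?_, ?_⟩
  · rw [hGU, key, key]
    simp only [mul_inv_mul_cancel]
  · rw [hGU, key, key]
    congr 3
    funext i
    by_cases h : d i = 0 <;> simp [h]
  · rw [← star_eq_conjTranspose, star_mul, star_mul, star_star, star_eq_conjTranspose (diagonal _),
      diagonal_conjTranspose, Matrix.mul_assoc]
    congr 3
    funext i
    simp [d]
  · rw [hGU, key, key]
    congr 3
    funext i
    ring

theorem exists_isMoorePenrose (A : Matrix m n ℂ) : ∃ B, IsMoorePenrose A B := by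
  classical
  obtain ⟨X, h1, h2, h3, h4⟩ :=
    exists_hermitian_generalizedInverse (isHermitian_conjTranspose_mul_self A)
  refine ⟨X * Aᴴ, ?_, ?_, ?_, ?_⟩
  · have h : (A * X * (Aᴴ * A) - A)ᴴ * (A * X * (Aᴴ * A) - A) = 0 := by
      have e : (A * X * (Aᴴ * A) - A)ᴴ * (A * X * (Aᴴ * A) - A) =
          ((Aᴴ * A) * X * (Aᴴ * A) - Aᴴ * A) * (X * (Aᴴ * A) - 1) := by
        simp only [conjTranspose_sub, conjTranspose_mul, conjTranspose_conjTranspose, h3,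
          Matrix.mul_sub, Matrix.sub_mul, Matrix.mul_assoc, Matrix.mul_one]
      rw [e, h1, sub_self, Matrix.zero_mul]
    rw [conjTranspose_mul_self_eq_zero, sub_eq_zero] at h
    simpa only [Matrix.mul_assoc] using h
  · calc X * Aᴴ * A * (X * Aᴴ) = (X * (Aᴴ * A) * X) * Aᴴ := by simp only [Matrix.mul_assoc]
      _ = X * Aᴴ := by rw [h2]
  · simp only [IsHermitian, conjTranspose_mul, conjTranspose_conjTranspose, h3, Matrix.mul_assoc]
  · have e : X * Aᴴ * A = X * (Aᴴ * A) := Matrix.mul_assoc _ _ _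
    rw [IsHermitian, e, conjTranspose_mul, h3, (isHermitian_conjTranspose_mul_self A).eq, h4]

/-- The Moore-Penrose inverse of a complex matrix. -/
noncomputable def mpInv (A : Matrix m n ℂ) : Matrix n m ℂ :=
  (exists_isMoorePenrose A).choose

theorem isMoorePenrose_mpInv (A : Matrix m n ℂ) : IsMoorePenrose A (mpInv A) :=
  (exists_isMoorePenrose A).choose_spec

end MoorePenrose

/-!
Sequences. A finite sequence `(s_j)_{j=0}^m` or an infinite sequence `(s_j)_{j=0}^∞` of complex
matrices is represented by a function `s : ℕ → Matrix _ _ ℂ` together with its last index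
`κ : ℕ∞`; every notion below that refers to `(s_j)_{j=0}^κ` involves only the values `s j` with
`j ≤ κ`.
-/

section Transforms

variable {p q : ℕ}

/-- The sequence generated by right-sided `α`-shifting: `-α s_j + s_{j+1}`. -/
noncomputable def rightShift (α : ℂ) (s : ℕ → Matrix (Fin p) (Fin q) ℂ) :
    ℕ → Matrix (Fin p) (Fin q) ℂ :=
  fun j => -(α • s j) + s (j + 1)

/-- The `[+,α]`-transform `-α s_{j-1} + s_j`, where `s_{-1} = 0`. -/
noncomputable def plusTransform (α : ℂ) (s : ℕ → Matrix (Fin p) (Fin q) ℂ) :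
    ℕ → Matrix (Fin p) (Fin q) ℂ
  | 0 => s 0
  | j + 1 => -(α • s j) + s (j + 1)

/-- The reciprocal sequence: `s_0^♯ = s_0^†` and
`s_j^♯ = -s_0^† ∑_{l=0}^{j-1} s_{j-l} s_l^♯` for `j ≥ 1`. -/
noncomputable def reciprocal (s : ℕ → Matrix (Fin p) (Fin q) ℂ) :
    ℕ → Matrix (Fin q) (Fin p) ℂ
  | 0 => mpInv (s 0)
  | j + 1 => -(mpInv (s 0) * ∑ l : Fin (j + 1), s (j + 1 - (l : ℕ)) * reciprocal s (l : ℕ))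
termination_by j => j
decreasing_by exact l.isLt

/-- The shortened negative reciprocal sequence corresponding to the `[+,α]`-transform. -/
noncomputable def shortReciprocal (α : ℂ) (s : ℕ → Matrix (Fin p) (Fin q) ℂ) :
    ℕ → Matrix (Fin q) (Fin p) ℂ :=
  fun j => -reciprocal (plusTransform α s) (j + 1)

/-- The first `α`-Schur-Stieltjes transform `s_j^{[1,α]}`. The terms with index `≤ κ - 1` depend
only on `s_0, …, s_κ`. -/
noncomputable def schurStieltjes (α : ℂ) (s : ℕ → Matrix (Fin p) (Fin q) ℂ) :
    ℕ → Matrix (Fin p) (Fin q) ℂ :=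
  fun j => s 0 * shortReciprocal α s j * s 0

end Transforms

section Classes

open scoped ComplexOrder

variable {q : ℕ}

/-- The block Hankel matrix `H_n = [s_{j+k}]_{j,k=0}^n`. -/
def blockHankel (s : ℕ → Matrix (Fin q) (Fin q) ℂ) (n : ℕ) :
    Matrix (Fin (n + 1) × Fin q) (Fin (n + 1) × Fin q) ℂ :=
  Matrix.of fun a b => s (a.1 + b.1) a.2 b.2

/-- The block column `y_{l,l+n} = col (s_l, …, s_{l+n})`. -/
def blockCol (s : ℕ → Matrix (Fin q) (Fin q) ℂ) (l n : ℕ) :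
    Matrix (Fin (n + 1) × Fin q) (Fin q) ℂ :=
  Matrix.of fun a b => s (l + a.1) a.2 b

/-- The block row `z_{l,l+n} = [s_l, …, s_{l+n}]`. -/
def blockRow (s : ℕ → Matrix (Fin q) (Fin q) ℂ) (l n : ℕ) :
    Matrix (Fin q) (Fin (n + 1) × Fin q) ℂ :=
  Matrix.of fun a b => s (l + b.1) a b.2

/-- `L_0 = s_0` and `L_n = s_{2n} - z_{n,2n-1} H_{n-1}^† y_{n,2n-1}` for `n ≥ 1`. -/
noncomputable def hankelSchur (s : ℕ → Matrix (Fin q) (Fin q) ℂ) :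
    ℕ → Matrix (Fin q) (Fin q) ℂ
  | 0 => s 0
  | n + 1 => s (2 * (n + 1)) -
      blockRow s (n + 1) n * mpInv (blockHankel s n) * blockCol s (n + 1) n

variable (q)

/-- `H^≥_{q,2n}`: the matrix `H_n` is nonnegative Hermitian. -/
def HNonneg (n : ℕ) : Set (ℕ → Matrix (Fin q) (Fin q) ℂ) :=
  {s | (blockHankel s n).PosSemidef}

/-- `H^>_{q,2n}`: the matrix `H_n` is positive Hermitian. -/
def HPos (n : ℕ) : Set (ℕ → Matrix (Fin q) (Fin q) ℂ) :=
  {s | (blockHankel s n).PosDef}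

/-- `H^{≥,cd}_{q,2n}`: the completely degenerate members of `H^≥_{q,2n}`. -/
def HNonnegCD (n : ℕ) : Set (ℕ → Matrix (Fin q) (Fin q) ℂ) :=
  {s | s ∈ HNonneg q n ∧ hankelSchur s n = 0}

/-- `K^≥_{q,m,α}` for finite `m`. For `m = 2n` or `m = 2n + 1` one has `m / 2 = n`; for
`m = 2n` with `n ≥ 1` one has `(m - 1) / 2 = n - 1`, and for `m = 2n + 1` it is `n`. -/
def KNonnegFin (α : ℝ) (m : ℕ) : Set (ℕ → Matrix (Fin q) (Fin q) ℂ) :=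
  {s | s ∈ HNonneg q (m / 2) ∧ (1 ≤ m → rightShift (α : ℂ) s ∈ HNonneg q ((m - 1) / 2))}

/-- `K^≥_{q,κ,α}` for `κ ∈ ℕ₀ ∪ {∞}`. -/
def KNonneg (α : ℝ) (κ : ℕ∞) : Set (ℕ → Matrix (Fin q) (Fin q) ℂ) :=
  ENat.recTopCoe (C := fun _ => Set (ℕ → Matrix (Fin q) (Fin q) ℂ))
    {s | ∀ m : ℕ, s ∈ KNonnegFin q α m} (fun m => KNonnegFin q α m) κ

/-- `K^{≥,e}_{q,κ,α}`: for finite `κ = m`, some choice of a further matrix `s_{m+1}` gives a member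
of `K^≥_{q,m+1,α}`; for `κ = ∞` it is `K^≥_{q,∞,α}`. -/
def KNonnegExt (α : ℝ) (κ : ℕ∞) : Set (ℕ → Matrix (Fin q) (Fin q) ℂ) :=
  ENat.recTopCoe (C := fun _ => Set (ℕ → Matrix (Fin q) (Fin q) ℂ))
    (KNonneg q α ⊤)
    (fun m => {s | ∃ t ∈ KNonnegFin q α (m + 1), ∀ j ≤ m, t j = s j}) κ

/-- `K^>_{q,m,α}` for finite `m`. -/
def KPosFin (α : ℝ) (m : ℕ) : Set (ℕ → Matrix (Fin q) (Fin q) ℂ) :=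
  {s | s ∈ HPos q (m / 2) ∧ (1 ≤ m → rightShift (α : ℂ) s ∈ HPos q ((m - 1) / 2))}

/-- `K^>_{q,κ,α}` for `κ ∈ ℕ₀ ∪ {∞}`. -/
def KPos (α : ℝ) (κ : ℕ∞) : Set (ℕ → Matrix (Fin q) (Fin q) ℂ) :=
  ENat.recTopCoe (C := fun _ => Set (ℕ → Matrix (Fin q) (Fin q) ℂ))
    {s | ∀ m : ℕ, s ∈ KPosFin q α m} (fun m => KPosFin q α m) κ

/-- `K^{≥,cd}_{q,m,α}` for finite `m`. -/
def KNonnegCDFin (α : ℝ) (m : ℕ) : Set (ℕ → Matrix (Fin q) (Fin q) ℂ) :=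
  {s | s ∈ KNonnegFin q α m ∧
    (∀ n : ℕ, m = 2 * n → s ∈ HNonnegCD q n) ∧
    (∀ n : ℕ, m = 2 * n + 1 → rightShift (α : ℂ) s ∈ HNonnegCD q n)}

/-- `K^{≥,cd}_{q,κ,α}` for `κ ∈ ℕ₀ ∪ {∞}`. -/
def KNonnegCD (α : ℝ) (κ : ℕ∞) : Set (ℕ → Matrix (Fin q) (Fin q) ℂ) :=
  ENat.recTopCoe (C := fun _ => Set (ℕ → Matrix (Fin q) (Fin q) ℂ))
    {s | s ∈ KNonneg q α ⊤ ∧ ∃ m : ℕ, s ∈ KNonnegCDFin q α m}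
    (fun m => KNonnegCDFin q α m) κ

/-- `K^{≥,cd_m}_{q,κ,α}`: members of `K^≥_{q,κ,α}` with `(s_j)_{j=0}^m` in `K^{≥,cd}_{q,m,α}`. -/
def KNonnegCDAt (α : ℝ) (κ : ℕ∞) (m : ℕ) : Set (ℕ → Matrix (Fin q) (Fin q) ℂ) :=
  {s | s ∈ KNonneg q α κ ∧ s ∈ KNonnegCDFin q α m}

end Classes

end StieltjesSeq

/-! Put P = s_0 s_0^† and regard sequences as power series with matrix coefficients. Suppose first
that every s_j is Hermitian with P s_j = s_j (`IsReduced`). Then u(z) = (1 - αz) s(z), its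
reciprocal r satisfies u r = r u = P, and the transform is t_j = -s_0 r_{j+1} s_0. Two congruences
carry the theorem: H_n(t) = L H_n^{(α)}(s) L^*, with L the lower triangular block Toeplitz matrix of
s_0 r(z); M H_{n+1}(s) M^* = diag(s_0, H_n^{(α)}(t)), with M that of s_0 (1 - αz) r(z). The diagonal
blocks of L and M would be P; since P fixes all the s_j they may be replaced by the identity
(`unitSeq`), which makes L and M invertible. So the transform exchanges the two Hankel families and
lowers the length by one, and both nonnegativity and definiteness pass over. Complete degeneracy
means that the kernel of the Hankel matrix contains a block column ending in the identity
(`hankelSchur_eq_zero_iff`); L^{-*} is unit upper triangular, so this survives too.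

For general s in K^≥_m, the kernel of s_0 lies in those of s_1, …, s_{m-1}, but perhaps not in that
of s_m. Passing to P s_j P (`compress`) therefore alters at most s_m; it keeps s in its class and
leaves t_0, …, t_{m-1} unchanged, so the reduced case applies. An extendable sequence is handled by
transforming its extension. -/

namespace StieltjesSeq

open Matrix
open scoped ComplexOrder

/-! ### Toeplitz matrices as power series, and their action on Hankel matrices -/

section Toeplitz

open Finset

variable {R : Type*} [Ring R]

/-- The lower triangular Toeplitz matrix of size `n + 1` of a sequence. -/
def lowerToeplitz (f : ℕ → R) (n : ℕ) : Matrix (Fin (n + 1)) (Fin (n + 1)) R :=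
  Matrix.of fun j a => if (a : ℕ) ≤ j then f (j - a) else 0

/-- The Hankel matrix of size `n + 1` of a sequence. -/
def hankel (s : ℕ → R) (n : ℕ) : Matrix (Fin (n + 1)) (Fin (n + 1)) R :=
  Matrix.of fun j k => s (j + k)

/-- The entry `∑ f_{j-a} s_{a+b} g_{k-b}` of a Hankel matrix multiplied by Toeplitz matrices. -/
def hankelConv (f s g : ℕ → R) (j k : ℕ) : R :=
  ∑ p ∈ antidiagonal j, ∑ r ∈ antidiagonal k, f p.1 * s (p.2 + r.2) * g r.1

theorem sum_fin_le_eq_sum_antidiagonal {n : ℕ} (j : Fin (n + 1)) (φ : ℕ → ℕ → R) :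
    ∑ a : Fin (n + 1), (if (a : ℕ) ≤ j then φ (j - a) a else 0) =
      ∑ p ∈ antidiagonal (j : ℕ), φ p.1 p.2 := by
  rw [Fin.sum_univ_eq_sum_range (fun a => if a ≤ (j : ℕ) then φ (j - a) a else 0) (n + 1),
    ← Finset.sum_filter, ← Finset.Nat.sum_antidiagonal_swap,
    Finset.Nat.sum_antidiagonal_eq_sum_range_succ_mk]
  refine Finset.sum_congr ?_ fun _ _ => rfl
  ext a
  simp only [mem_filter, mem_range]
  have := j.isLt
  omega

theorem sum_antidiagonal_add (f : ℕ → ℕ → R) (a d : ℕ) :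
    ∑ p ∈ antidiagonal (a + d), (if a ≤ p.2 then f p.1 (p.2 - a) else 0) =
      ∑ p ∈ antidiagonal d, f p.1 p.2 := by
  induction a with
  | zero => simp
  | succ a ih =>
    rw [show a + 1 + d = a + d + 1 by omega, Finset.Nat.sum_antidiagonal_succ', ← ih]
    simp

theorem lowerToeplitz_mul (f g : ℕ → R) (n : ℕ) :
    lowerToeplitz f n * lowerToeplitz g n =
      lowerToeplitz (fun m => PowerSeries.coeff m (PowerSeries.mk f * PowerSeries.mk g)) n := by
  ext j a
  simp only [Matrix.mul_apply, lowerToeplitz, Matrix.of_apply, ite_mul, zero_mul]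
  rw [sum_fin_le_eq_sum_antidiagonal j
    (fun c b => f c * (if (a : ℕ) ≤ b then g (b - a) else 0))]
  simp only [mul_ite, mul_zero, PowerSeries.coeff_mul, PowerSeries.coeff_mk]
  split_ifs with h
  · obtain ⟨d, hd⟩ := Nat.exists_eq_add_of_le h
    rw [hd, Nat.add_sub_cancel_left, sum_antidiagonal_add (fun c b => f c * g b)]
  · refine Finset.sum_eq_zero fun p hp => if_neg ?_
    have := mem_antidiagonal.1 hp
    omega

theorem lowerToeplitz_one (n : ℕ) :
    lowerToeplitz (fun m => PowerSeries.coeff m (1 : PowerSeries R)) n = 1 := by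
  ext j a
  simp only [lowerToeplitz, Matrix.of_apply, PowerSeries.coeff_one, Matrix.one_apply, Fin.ext_iff]
  have := j.isLt
  by_cases h : (j : ℕ) = a
  · simp [h]
  · rw [if_neg h]
    split_ifs <;> first | rfl | omega

/-- The coefficients of the inverse power series give one sequence that works for every size n; it
again starts with 1. -/
theorem exists_lowerToeplitz_inverse (f : ℕ → R) (hf : f 0 = 1) :
    ∃ g : ℕ → R, g 0 = 1 ∧ ∀ n, lowerToeplitz f n * lowerToeplitz g n = 1 ∧
      lowerToeplitz g n * lowerToeplitz f n = 1 := by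
  have hc : PowerSeries.constantCoeff (PowerSeries.mk f) = ((1 : Rˣ) : R) := by simp [hf]
  let G := PowerSeries.invOfUnit (PowerSeries.mk f) 1
  have hG : PowerSeries.mk (fun m => PowerSeries.coeff m G) = G := by ext; simp
  refine ⟨fun m => PowerSeries.coeff m G, by simp [G], fun n => ⟨?_, ?_⟩⟩
  · rw [lowerToeplitz_mul, hG, PowerSeries.mul_invOfUnit _ _ hc, lowerToeplitz_one]
  · rw [lowerToeplitz_mul, hG, PowerSeries.invOfUnit_mul _ _ hc, lowerToeplitz_one]

theorem lowerToeplitz_mul_hankel_mul [StarRing R] (f s g : ℕ → R) (n : ℕ)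
    (j k : Fin (n + 1)) :
    (lowerToeplitz f n * hankel s n * (lowerToeplitz g n)ᴴ) j k =
      hankelConv f s (fun i => star (g i)) j k := by
  have h : ∀ b : Fin (n + 1), (lowerToeplitz f n * hankel s n) j b =
      ∑ p ∈ antidiagonal (j : ℕ), f p.1 * s (p.2 + b) := by
    intro b
    simp only [Matrix.mul_apply, lowerToeplitz, hankel, Matrix.of_apply, ite_mul, zero_mul]
    exact sum_fin_le_eq_sum_antidiagonal j (fun c a => f c * s (a + b))
  rw [Matrix.mul_apply, Finset.sum_congr rfl fun b _ => by rw [h]]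
  simp only [lowerToeplitz, conjTranspose_apply, Matrix.of_apply, apply_ite star, star_zero,
    mul_ite, mul_zero]
  rw [sum_fin_le_eq_sum_antidiagonal k
    (fun c b => (∑ p ∈ antidiagonal (j : ℕ), f p.1 * s (p.2 + b)) * star (g c)),
    hankelConv, Finset.sum_comm]
  simp only [Finset.sum_mul]

/-- Displacement identity: all interior terms depend on a + b only and cancel, so just the boundary
terms remain. It measures how far the congruent matrix is from being Hankel. -/
theorem hankelConv_succ_left (f s g : ℕ → R) (j k : ℕ) :
    hankelConv f s g (j + 1) k - hankelConv f s g j (k + 1) =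
      f (j + 1) * (∑ r ∈ antidiagonal k, s r.2 * g r.1) -
        (∑ p ∈ antidiagonal j, f p.1 * s p.2) * g (k + 1) := by
  simp only [hankelConv, Finset.Nat.sum_antidiagonal_succ', Finset.sum_add_distrib,
    Finset.mul_sum, Finset.sum_mul, Nat.zero_add, Nat.add_zero, mul_assoc,
    Nat.add_right_comm _ 1, ← Nat.add_assoc]
  abel

theorem hankelConv_congr {f f' s g g' : ℕ → R} (hf : ∀ j k, f j * s k = f' j * s k)
    (hg : ∀ j k, s k * g j = s k * g' j) : hankelConv f s g = hankelConv f' s g' := by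
  ext j k
  refine Finset.sum_congr rfl fun p _ => Finset.sum_congr rfl fun r _ => ?_
  rw [hf, mul_assoc, hg, ← mul_assoc]

end Toeplitz

/-! ### Block columns and matrices over the matrix ring -/

section BlockMatrices

variable {N q : ℕ}

/-- The block column with blocks `x_0, …, x_{N-1}`. -/
def stack (x : Fin N → Matrix (Fin q) (Fin q) ℂ) : Matrix (Fin N × Fin q) (Fin q) ℂ :=
  Matrix.of fun a b => x a.1 a.2 b

theorem stack_injective : Function.Injective (stack (N := N) (q := q)) := by
  intro x y h
  ext j a b
  exact congrFun (congrFun h (j, a)) b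

theorem stack_zero : stack (0 : Fin N → Matrix (Fin q) (Fin q) ℂ) = 0 := rfl

theorem exists_stack (Y : Matrix (Fin N × Fin q) (Fin q) ℂ) : ∃ x, stack x = Y :=
  ⟨fun j => Matrix.of fun a b => Y (j, a) b, rfl⟩

theorem comp_mul_stack {M : ℕ} (A : Matrix (Fin M) (Fin N) (Matrix (Fin q) (Fin q) ℂ))
    (x : Fin N → Matrix (Fin q) (Fin q) ℂ) :
    comp _ _ _ _ _ A * stack x = stack (A *ᵥ x) := by
  ext a b
  simp only [Matrix.mul_apply, stack, comp_apply, Matrix.of_apply, Fintype.sum_prod_type,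
    mulVec, dotProduct, Matrix.sum_apply]

theorem conjTranspose_stack_mul_stack (x y : Fin N → Matrix (Fin q) (Fin q) ℂ) :
    (stack x)ᴴ * stack y = ∑ j, (x j)ᴴ * y j := by
  ext a b
  simp only [Matrix.mul_apply, stack, conjTranspose_apply, Matrix.of_apply, Fintype.sum_prod_type,
    Matrix.sum_apply]

theorem comp_mul_mul_conjTranspose (A B : Matrix (Fin N) (Fin N) (Matrix (Fin q) (Fin q) ℂ)) :
    comp _ _ _ _ _ (A * B * Aᴴ) = comp _ _ _ _ _ A * comp _ _ _ _ _ B * (comp _ _ _ _ _ A)ᴴ := by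
  have h : comp _ _ _ _ _ Aᴴ = (comp _ _ _ _ _ A)ᴴ := rfl
  rw [← h]
  simp only [← compRingEquiv_apply, map_mul]

/-- The diagonal entries of Y^* M Y are the quadratic form at the columns of Y, and an isotropic
vector of a nonnegative form lies in the kernel. -/
theorem PosSemidef_mul_stack_eq_zero {M : Matrix (Fin N × Fin q) (Fin N × Fin q) ℂ}
    (hM : M.PosSemidef) {Y : Matrix (Fin N × Fin q) (Fin q) ℂ} (h : Yᴴ * (M * Y) = 0) :
    M * Y = 0 := by
  ext a c
  have h1 : star (Y.col c) ⬝ᵥ (M *ᵥ Y.col c) = 0 := congrFun (congrFun h c) c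
  exact congrFun ((hM.dotProduct_mulVec_zero_iff _).1 h1) a

end BlockMatrices

/-! ### Kernels of nonnegative block Hankel matrices and degeneracy -/

section BlockHankel

variable {q : ℕ} {s s' : ℕ → Matrix (Fin q) (Fin q) ℂ} {n : ℕ}

theorem blockHankel_eq_comp : blockHankel s n = comp _ _ _ _ _ (hankel s n) := rfl

theorem hankel_congr (h : ∀ j ≤ 2 * n, s j = s' j) : hankel s n = hankel s' n := by
  refine Matrix.ext fun j k => h (j + k) ?_
  have := j.isLt
  have := k.isLt
  omega

theorem blockHankel_congr (h : ∀ j ≤ 2 * n, s j = s' j) : blockHankel s n = blockHankel s' n := by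
  rw [blockHankel_eq_comp, hankel_congr h, blockHankel_eq_comp]

theorem isHermitian_of_blockHankel (h : (blockHankel s n).IsHermitian) {j : ℕ} (hj : j ≤ 2 * n) :
    (s j).IsHermitian := by
  obtain ⟨a, b, ha, hb, rfl⟩ : ∃ a b, a ≤ n ∧ b ≤ n ∧ j = a + b :=
    ⟨j / 2, j - j / 2, by omega, by omega, by omega⟩
  ext x y
  have := congrFun (congrFun h (⟨a, by omega⟩, x)) (⟨b, by omega⟩, y)
  simpa [blockHankel, conjTranspose_apply, Nat.add_comm b a] using this

theorem isHermitian_blockHankel (h : ∀ j ≤ 2 * n, (s j).IsHermitian) :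
    (blockHankel s n).IsHermitian := by
  ext a b
  have := h (b.1 + a.1) (by have := a.1.isLt; have := b.1.isLt; omega)
  simpa [blockHankel, conjTranspose_apply, Nat.add_comm] using congrFun (congrFun this a.2) b.2

/-- The kernel of the block `s_{2k}` of a nonnegative block Hankel matrix is contained in the
kernels of the blocks of the same block column. -/
theorem mul_eq_zero_of_diag (h : (blockHankel s n).PosSemidef) {k j : ℕ} (hk : k ≤ n) (hj : j ≤ n)
    {E : Matrix (Fin q) (Fin q) ℂ} (hE : s (2 * k) * E = 0) : s (j + k) * E = 0 := by
  let k' : Fin (n + 1) := ⟨k, by omega⟩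
  have hx : hankel s n *ᵥ Pi.single k' E = fun j : Fin (n + 1) => s (j + k) * E := by
    ext1 j
    rw [mulVec, dotProduct, Finset.sum_eq_single k']
    · simp [hankel, k']
    · intro b _ hb
      simp [hb]
    · simp
  have h0 := PosSemidef_mul_stack_eq_zero h (Y := stack (Pi.single k' E)) (by
    rw [blockHankel_eq_comp, comp_mul_stack, conjTranspose_stack_mul_stack, hx,
      Finset.sum_eq_single k']
    · simp [k', ← two_mul, hE]
    · intro b _ hb
      simp [hb]
    · simp)
  rw [blockHankel_eq_comp, comp_mul_stack, hx, ← stack_zero] at h0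
  exact congrFun (stack_injective h0) ⟨j, by omega⟩

theorem mul_eq_zero_of_zero (h : (blockHankel s n).PosSemidef) {E : Matrix (Fin q) (Fin q) ℂ}
    (hE : s 0 * E = 0) : ∀ j < 2 * n, s j * E = 0 := by
  intro j
  induction j using Nat.strong_induction_on with
  | _ j ih =>
    intro hj
    rcases le_or_gt j n with hjn | hjn
    · exact mul_eq_zero_of_diag h (k := 0) (by omega) hjn hE
    -- The block s_j with j > n sits in the last row, in the block column whose diagonal block is
    -- s_{2(j-n)}; 2(j - n) < j holds exactly because j < 2n, so s_{2n} itself is out of reach.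
    · have := mul_eq_zero_of_diag h (k := j - n) (j := n) (by omega) le_rfl
        (ih (2 * (j - n)) (by omega) (by omega))
      rwa [show n + (j - n) = j by omega] at this

theorem hankel_succ_mulVec_castSucc (x : Fin (n + 2) → Matrix (Fin q) (Fin q) ℂ)
    (j : Fin (n + 1)) : (hankel s (n + 1) *ᵥ x) j.castSucc =
      (hankel s n *ᵥ fun k => x k.castSucc) j + s (n + 1 + j) * x (Fin.last _) := by
  simp only [mulVec, dotProduct, hankel, Matrix.of_apply, Fin.sum_univ_castSucc, Fin.val_castSucc,
    Fin.val_last, Nat.add_comm (j : ℕ) (n + 1)]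

theorem hankel_succ_mulVec_last (x : Fin (n + 2) → Matrix (Fin q) (Fin q) ℂ) :
    (hankel s (n + 1) *ᵥ x) (Fin.last _) =
      (∑ k : Fin (n + 1), s (n + 1 + k) * x k.castSucc) + s (2 * (n + 1)) * x (Fin.last _) := by
  simp only [mulVec, dotProduct, hankel, Matrix.of_apply, Fin.sum_univ_castSucc, Fin.val_castSucc,
    Fin.val_last, two_mul]

theorem blockRow_eq (h : ∀ j ≤ 2 * n + 1, (s j).IsHermitian) :
    blockRow s (n + 1) n = (blockCol s (n + 1) n)ᴴ := by
  ext a b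
  have := h (n + 1 + b.1) (by have := b.1.isLt; omega)
  simpa [blockRow, blockCol, conjTranspose_apply] using (congrFun (congrFun this a) b.2).symm

theorem blockCol_eq_stack (l : ℕ) :
    blockCol s l n = stack (fun j : Fin (n + 1) => s (l + j)) := rfl

/-- The range of the off-diagonal block y lies in that of H. The component z of y orthogonal to the
range of H, padded by a zero block, is isotropic for the larger matrix and hence in its kernel; the
last block row then says y^* z = 0, which forces z = 0. -/
theorem blockHankel_mul_mpInv_mul_blockCol (h : (blockHankel s (n + 1)).PosSemidef) :
    blockHankel s n * mpInv (blockHankel s n) * blockCol s (n + 1) n =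
      blockCol s (n + 1) n := by
  set H := blockHankel s n with hH
  have hH' := isMoorePenrose_mpInv H
  set y := blockCol s (n + 1) n with hy
  have hs : ∀ j ≤ 2 * (n + 1), (s j).IsHermitian := fun j hj =>
    isHermitian_of_blockHankel h.isHermitian hj
  have hHh : Hᴴ = H := isHermitian_blockHankel fun j hj => hs j (by omega)
  set z := y - H * mpInv H * y with hz
  have hHz : H * z = 0 := by
    have e : H * (H * mpInv H) = H := by
      have := congrArg conjTranspose hH'.mul_mul_self
      rwa [conjTranspose_mul, hH'.isHermitian_left, hHh] at this
    rw [hz, Matrix.mul_sub, ← Matrix.mul_assoc, e, sub_self]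
  obtain ⟨x, hx⟩ := exists_stack z
  have hHx : hankel s n *ᵥ x = 0 := by
    apply stack_injective
    rw [← comp_mul_stack, hx, ← blockHankel_eq_comp, ← hH, hHz, stack_zero]
  let w : Fin (n + 2) → Matrix (Fin q) (Fin q) ℂ := Fin.snoc x 0
  have hw : ∀ j : Fin (n + 1), (hankel s (n + 1) *ᵥ w) j.castSucc = 0 := by
    intro j
    rw [hankel_succ_mulVec_castSucc]
    simp [w, hHx]
  have h0 := PosSemidef_mul_stack_eq_zero h (Y := stack w) (by
    rw [blockHankel_eq_comp, comp_mul_stack, conjTranspose_stack_mul_stack,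
      Fin.sum_univ_castSucc]
    simp [hw]
    simp [w])
  rw [blockHankel_eq_comp, comp_mul_stack, ← stack_zero] at h0
  have hl := congrFun (stack_injective h0) (Fin.last _)
  rw [hankel_succ_mulVec_last] at hl
  have hyz : yᴴ * z = 0 := by
    rw [← hx, hy, blockCol_eq_stack, conjTranspose_stack_mul_stack]
    simp only [Pi.zero_apply] at hl
    rw [← hl]
    simp only [w, Fin.snoc_castSucc, Fin.snoc_last, mul_zero, add_zero]
    refine Finset.sum_congr rfl fun k _ => ?_
    rw [hs _ (by have := k.isLt; omega)]
  have hzz : zᴴ * z = 0 := by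
    have e : zᴴ = yᴴ - yᴴ * (H * mpInv H) := by
      rw [hz, conjTranspose_sub, conjTranspose_mul, hH'.isHermitian_left]
    have e2 : H * mpInv H * z = 0 := by
      rw [hz, Matrix.mul_sub, ← Matrix.mul_assoc, ← Matrix.mul_assoc (H * mpInv H) H,
        hH'.mul_mul_self, sub_self]
    rw [e, Matrix.sub_mul, hyz, Matrix.mul_assoc, e2, Matrix.mul_zero, sub_zero]
  exact (sub_eq_zero.1 (conjTranspose_mul_self_eq_zero.1 hzz)).symm

/-- A nonnegative block Hankel matrix has vanishing last Schur complement iff its kernel contains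
a block column whose last block is the identity. -/
theorem hankelSchur_eq_zero_iff (h : (blockHankel s n).PosSemidef) :
    hankelSchur s n = 0 ↔ ∃ x : Fin (n + 1) → Matrix (Fin q) (Fin q) ℂ,
      x (Fin.last n) = 1 ∧ hankel s n *ᵥ x = 0 := by
  cases n with
  | zero =>
    rw [hankelSchur]
    constructor
    · intro h0
      refine ⟨1, rfl, ?_⟩
      ext1 j
      fin_cases j
      simp [mulVec, dotProduct, hankel, h0]
    · rintro ⟨x, hx, h0⟩
      have : ∑ i : Fin 1, s (0 + i) * x i = 0 := congrFun h0 0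
      rw [Fin.sum_univ_one, show x 0 = 1 from hx] at this
      simpa using this
  | succ n =>
    rw [hankelSchur]
    have hs : ∀ j ≤ 2 * (n + 1), (s j).IsHermitian := fun j hj =>
      isHermitian_of_blockHankel h.isHermitian hj
    have hrange := blockHankel_mul_mpInv_mul_blockCol h
    rw [blockRow_eq fun j hj => hs j (by omega)]
    set H := blockHankel s n with hH
    set y := blockCol s (n + 1) n with hy
    have hsum : ∀ x : Fin (n + 2) → Matrix (Fin q) (Fin q) ℂ,
        ∑ k : Fin (n + 1), s (n + 1 + k) * x k.castSucc = yᴴ * stack fun k => x k.castSucc := by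
      intro x
      rw [hy, blockCol_eq_stack, conjTranspose_stack_mul_stack]
      refine Finset.sum_congr rfl fun k _ => ?_
      rw [hs _ (by have := k.isLt; omega)]
    have hker : ∀ x : Fin (n + 2) → Matrix (Fin q) (Fin q) ℂ, x (Fin.last _) = 1 →
        (hankel s (n + 1) *ᵥ x = 0 ↔ H * (stack fun k => x k.castSucc) + y = 0 ∧
          (yᴴ * stack fun k => x k.castSucc) + s (2 * (n + 1)) = 0) := by
      intro x hx
      rw [funext_iff, Fin.forall_fin_succ', hankel_succ_mulVec_last, hsum, hx]
      refine and_congr ?_ (by simp)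
      rw [hH, blockHankel_eq_comp, comp_mul_stack, hy, blockCol_eq_stack]
      have e : stack (hankel s n *ᵥ fun k => x k.castSucc) +
          stack (fun j : Fin (n + 1) => s (n + 1 + j)) =
          stack fun j => (hankel s (n + 1) *ᵥ x) j.castSucc := by
        ext a b
        simp [stack, hankel_succ_mulVec_castSucc, hx]
      rw [e, ← stack_zero, stack_injective.eq_iff, funext_iff]
      rfl
    constructor
    · intro h0
      -- Block elimination: this solves H X + y = 0 by the range inclusion, and the last block row
      -- becomes the Schur complement.
      obtain ⟨x, hx⟩ := exists_stack (-(mpInv H * y))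
      refine ⟨Fin.snoc x 1, by simp, (hker _ (by simp)).2 ?_⟩
      simp only [Fin.snoc_castSucc]
      rw [hx, Matrix.mul_neg, Matrix.mul_neg, ← Matrix.mul_assoc, hrange, neg_add_cancel,
        ← Matrix.mul_assoc, neg_add_eq_sub]
      exact ⟨rfl, h0⟩
    · rintro ⟨x, hx, h0⟩
      obtain ⟨h1, h2⟩ := (hker x hx).1 h0
      set X := stack fun k : Fin (n + 1) => x k.castSucc
      have hHh : Hᴴ = H := isHermitian_blockHankel fun j hj => hs j (by omega)
      have hyX : y = -(H * X) := (neg_eq_of_add_eq_zero_right h1).symm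
      have e : yᴴ * mpInv H * y = -(yᴴ * X) := by
        have hyH : yᴴ = -(Xᴴ * H) := by rw [hyX, conjTranspose_neg, conjTranspose_mul, hHh]
        calc yᴴ * mpInv H * y = yᴴ * mpInv H * (-(H * X)) := by rw [← hyX]
          _ = Xᴴ * (H * mpInv H * H) * X := by
            rw [hyH]
            simp only [Matrix.mul_assoc, Matrix.neg_mul, Matrix.mul_neg, neg_neg]
          _ = -(yᴴ * X) := by
            rw [(isMoorePenrose_mpInv H).mul_mul_self, hyH, Matrix.neg_mul, neg_neg]
      rw [e, sub_neg_eq_add, add_comm]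
      exact h2

end BlockHankel

/-! ### Moore–Penrose inverses of Hermitian matrices and reciprocal sequences -/

section Reciprocal

variable {q : ℕ}

theorem IsMoorePenrose.conjTranspose {m n : Type*} [Fintype m] [Fintype n] {A : Matrix m n ℂ}
    {B : Matrix n m ℂ} (h : IsMoorePenrose A B) : IsMoorePenrose Aᴴ Bᴴ where
  mul_mul_self := by
    rw [← conjTranspose_mul, ← conjTranspose_mul, ← Matrix.mul_assoc, h.mul_mul_self]
  self_mul_mul := by
    rw [← conjTranspose_mul, ← conjTranspose_mul, ← Matrix.mul_assoc, h.self_mul_mul]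
  isHermitian_left := by
    rw [← conjTranspose_mul, IsHermitian, h.isHermitian_right.eq, h.isHermitian_right.eq]
  isHermitian_right := by
    rw [← conjTranspose_mul, IsHermitian, h.isHermitian_left.eq, h.isHermitian_left.eq]

theorem mpInv_mul_mul_mpInv (A : Matrix (Fin q) (Fin q) ℂ) :
    mpInv A * (A * mpInv A) = mpInv A := by
  rw [← Matrix.mul_assoc, (isMoorePenrose_mpInv A).self_mul_mul]

section Hermitian

variable {A : Matrix (Fin q) (Fin q) ℂ} (hA : A.IsHermitian)
include hA

theorem mpInv_isHermitian : (mpInv A).IsHermitian := by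
  have h := (isMoorePenrose_mpInv A).conjTranspose
  rw [hA.eq] at h
  exact h.unique (isMoorePenrose_mpInv A)

theorem mul_mpInv_comm : A * mpInv A = mpInv A * A := by
  have h := (isMoorePenrose_mpInv A).isHermitian_left.eq
  rwa [conjTranspose_mul, hA.eq, (mpInv_isHermitian hA).eq, eq_comm] at h

theorem mul_mpInv_mul_mpInv : A * mpInv A * mpInv A = mpInv A := by
  rw [mul_mpInv_comm hA, (isMoorePenrose_mpInv A).self_mul_mul]

theorem mul_mul_mpInv : A * (A * mpInv A) = A := by
  rw [mul_mpInv_comm hA, ← Matrix.mul_assoc, (isMoorePenrose_mpInv A).mul_mul_self]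

end Hermitian

variable {u w : ℕ → Matrix (Fin q) (Fin q) ℂ}

theorem reciprocal_zero : reciprocal u 0 = mpInv (u 0) := by rw [reciprocal]

theorem reciprocal_succ (j : ℕ) : reciprocal u (j + 1) =
    -(mpInv (u 0) * ∑ l ∈ Finset.range (j + 1), u (j + 1 - l) * reciprocal u l) := by
  rw [reciprocal, Fin.sum_univ_eq_sum_range (fun l => u (j + 1 - l) * reciprocal u l)]

theorem mul_mpInv_mul_reciprocal (h : (u 0).IsHermitian) (j : ℕ) :
    u 0 * mpInv (u 0) * reciprocal u j = reciprocal u j := by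
  cases j with
  | zero => rw [reciprocal_zero, mul_mpInv_mul_mpInv h]
  | succ j => rw [reciprocal_succ, Matrix.mul_neg, ← Matrix.mul_assoc, mul_mpInv_mul_mpInv h]

/-- The reciprocal sequence only depends on the compressions of the terms to the range of the
initial one. -/
theorem reciprocal_congr (h : (u 0).IsHermitian) {m : ℕ} (h0 : w 0 = u 0)
    (hw : ∀ j ≤ m, w j = u 0 * mpInv (u 0) * u j * (u 0 * mpInv (u 0))) :
    ∀ j ≤ m, reciprocal w j = reciprocal u j := by
  intro j
  induction j using Nat.strong_induction_on with
  | _ j ih =>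
    intro hj
    cases j with
    | zero => rw [reciprocal_zero, reciprocal_zero, h0]
    | succ j =>
      rw [reciprocal_succ, reciprocal_succ, h0, Finset.mul_sum, Finset.mul_sum]
      congr 1
      refine Finset.sum_congr rfl fun l hl => ?_
      have hl := Finset.mem_range.1 hl
      -- The compressing projections are absorbed on the left by u_0^† and on the right by the
      -- reciprocal terms.
      rw [ih l hl (by omega), hw _ (by omega), Matrix.mul_assoc _ _ (reciprocal u l),
        mul_mpInv_mul_reciprocal h, Matrix.mul_assoc _ (u (j + 1 - l)), ← Matrix.mul_assoc,
        mpInv_mul_mul_mpInv]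

theorem mk_mul_mk_reciprocal (h : ∀ j, u 0 * mpInv (u 0) * u j = u j) :
    PowerSeries.mk u * PowerSeries.mk (reciprocal u) = PowerSeries.C (u 0 * mpInv (u 0)) := by
  ext1 n
  rw [PowerSeries.coeff_mul, PowerSeries.coeff_C]
  simp only [PowerSeries.coeff_mk]
  cases n with
  | zero => simp [reciprocal_zero]
  | succ n =>
    rw [if_neg (by omega), ← Finset.Nat.sum_antidiagonal_swap,
      Finset.Nat.sum_antidiagonal_eq_sum_range_succ_mk, Finset.sum_range_succ]
    simp only [Prod.swap_prod_mk, Nat.sub_self]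
    rw [reciprocal_succ, Matrix.mul_neg, ← Matrix.mul_assoc, Finset.mul_sum,
      add_neg_eq_zero]
    refine Finset.sum_congr rfl fun l _ => ?_
    rw [← Matrix.mul_assoc, h]

/-- Taking adjoints in u r = P gives r^* u = P, so r^* = r^* P = r^* u r = P r = r coefficientwise.
-/
theorem reciprocal_isHermitian (hu : ∀ j, (u j).IsHermitian)
    (h : ∀ j, u 0 * mpInv (u 0) * u j = u j) (j : ℕ) : (reciprocal u j).IsHermitian := by
  set P := u 0 * mpInv (u 0) with hP
  set r := reciprocal u with hr
  have hPh : Pᴴ = P := (isMoorePenrose_mpInv (u 0)).isHermitian_left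
  have e1 : PowerSeries.mk u * PowerSeries.mk r = PowerSeries.C P := mk_mul_mk_reciprocal h
  have e2 : PowerSeries.mk (fun j => (r j)ᴴ) * PowerSeries.mk u = PowerSeries.C P := by
    ext1 n
    have := congrArg Matrix.conjTranspose (congrArg (PowerSeries.coeff n) e1)
    rw [PowerSeries.coeff_mul, conjTranspose_sum, ← Finset.Nat.sum_antidiagonal_swap] at this
    rw [PowerSeries.coeff_mul]
    simp only [PowerSeries.coeff_mk, Prod.fst_swap, Prod.snd_swap, conjTranspose_mul,
      (hu _).eq] at this ⊢
    rw [this, PowerSeries.coeff_C]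
    split_ifs <;> simp [hPh]
  have e3 : PowerSeries.C P * PowerSeries.mk r = PowerSeries.mk r := by
    ext1 n
    rw [PowerSeries.coeff_C_mul, PowerSeries.coeff_mk, hr, hP, mul_mpInv_mul_reciprocal (hu 0)]
  have e4 : PowerSeries.mk (fun j => (r j)ᴴ) * PowerSeries.C P =
      PowerSeries.mk (fun j => (r j)ᴴ) := by
    ext1 n
    rw [PowerSeries.coeff_mul_C, PowerSeries.coeff_mk, ← hPh, ← conjTranspose_mul, hr, hP,
      mul_mpInv_mul_reciprocal (hu 0)]
  have e5 : PowerSeries.mk (fun j => (r j)ᴴ) = PowerSeries.mk r := by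
    rw [← e4, ← e1, ← mul_assoc, e2, e3]
  have := congrArg (PowerSeries.coeff j) e5
  rwa [PowerSeries.coeff_mk, PowerSeries.coeff_mk] at this

end Reciprocal

/-! ### Convolution identities for reduced sequences -/

section Reduced

open Finset.HasAntidiagonal (antidiagonal)

variable {q : ℕ} {s : ℕ → Matrix (Fin q) (Fin q) ℂ}

/-- A sequence of Hermitian matrices with ranges contained in the range of the initial one. -/
structure IsReduced (s : ℕ → Matrix (Fin q) (Fin q) ℂ) : Prop where
  isHermitian : ∀ j, (s j).IsHermitian
  proj_mul : ∀ j, s 0 * mpInv (s 0) * s j = s j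

theorem IsReduced.mul_proj (h : IsReduced s) (j : ℕ) : s j * (s 0 * mpInv (s 0)) = s j := by
  have := congrArg conjTranspose (h.proj_mul j)
  rwa [conjTranspose_mul, (isMoorePenrose_mpInv (s 0)).isHermitian_left, (h.isHermitian j).eq]
    at this

variable (α : ℝ)

theorem isHermitian_shift {A B : Matrix (Fin q) (Fin q) ℂ} (hA : A.IsHermitian)
    (hB : B.IsHermitian) : (-((α : ℂ) • A) + B).IsHermitian := by
  rw [IsHermitian, conjTranspose_add, conjTranspose_neg, conjTranspose_smul, hA.eq, hB.eq]
  simp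

theorem IsReduced.isReduced_plusTransform (h : IsReduced s) :
    IsReduced (plusTransform (α : ℂ) s) where
  isHermitian j := by
    cases j with
    | zero => exact h.isHermitian 0
    | succ j => exact isHermitian_shift α (h.isHermitian j) (h.isHermitian (j + 1))
  proj_mul j := by
    cases j with
    | zero => exact h.proj_mul 0
    | succ j =>
      change s 0 * mpInv (s 0) * (-((α : ℂ) • s j) + s (j + 1)) = -((α : ℂ) • s j) + s (j + 1)
      rw [Matrix.mul_add, Matrix.mul_neg, Matrix.mul_smul, h.proj_mul, h.proj_mul]

theorem IsReduced.reciprocal_isHermitian (h : IsReduced s) (j : ℕ) :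
    (reciprocal s j).IsHermitian :=
  StieltjesSeq.reciprocal_isHermitian h.isHermitian h.proj_mul j

theorem IsReduced.sum_mul_reciprocal (h : IsReduced s) (j : ℕ) :
    ∑ p ∈ antidiagonal j, s p.2 * reciprocal s p.1 =
      if j = 0 then s 0 * mpInv (s 0) else 0 := by
  have := congrArg (PowerSeries.coeff j) (mk_mul_mk_reciprocal h.proj_mul)
  rw [PowerSeries.coeff_mul, PowerSeries.coeff_C, ← Finset.Nat.sum_antidiagonal_swap] at this
  simpa using this

theorem IsReduced.sum_reciprocal_mul (h : IsReduced s) (j : ℕ) :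
    ∑ p ∈ antidiagonal j, reciprocal s p.1 * s p.2 =
      if j = 0 then s 0 * mpInv (s 0) else 0 := by
  have := congrArg conjTranspose (h.sum_mul_reciprocal j)
  simp only [conjTranspose_sum, conjTranspose_mul, (h.isHermitian _).eq,
    (h.reciprocal_isHermitian _).eq] at this
  rw [this]
  split_ifs
  · exact (isMoorePenrose_mpInv (s 0)).isHermitian_left
  · exact conjTranspose_zero

/-- The sequence `s_0 f_j` with its initial term replaced by the identity. -/
def unitSeq (A : Matrix (Fin q) (Fin q) ℂ) (f : ℕ → Matrix (Fin q) (Fin q) ℂ) :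
    ℕ → Matrix (Fin q) (Fin q) ℂ
  | 0 => 1
  | j + 1 => A * f (j + 1)

theorem schurStieltjes_apply (a : ℂ) (j : ℕ) : schurStieltjes a s j =
    -(s 0 * reciprocal (plusTransform a s) (j + 1) * s 0) := by
  simp only [schurStieltjes, shortReciprocal, Matrix.mul_neg, Matrix.neg_mul]

/-- Only the products with the v_j matter, and there the leading coefficient A A^† acts as the
identity. -/
theorem hankelConv_unitSeq {f v : ℕ → Matrix (Fin q) (Fin q) ℂ} {A : Matrix (Fin q) (Fin q) ℂ}
    (hA : A.IsHermitian) (hf : ∀ j, (f j).IsHermitian) (hf0 : f 0 = mpInv A)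
    (hv : ∀ j, A * mpInv A * v j = v j) (hv' : ∀ j, v j * (A * mpInv A) = v j) :
    hankelConv (unitSeq A f) v (fun i => star (unitSeq A f i)) =
      hankelConv (fun j => A * f j) v (fun j => f j * A) := by
  apply hankelConv_congr
  · intro j k
    cases j with
    | zero => rw [unitSeq, hf0, hv, Matrix.one_mul]
    | succ j => rfl
  · intro j k
    cases j with
    | zero => rw [unitSeq, hf0, star_one, Matrix.mul_one, ← mul_mpInv_comm hA, hv']
    | succ j =>
      rw [unitSeq, star_eq_conjTranspose, conjTranspose_mul, hA.eq, (hf _).eq]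

/-- Since v is u with its first term removed, u r = P turns both boundary terms of the displacement
identity into -s_0 r_{j+1} s_0 r_{k+1} s_0. They cancel, so the entries depend on j + k only, and
row 0 identifies them. -/
theorem hankelConv_rightShift (h : IsReduced s) (j k : ℕ) :
    hankelConv (fun j => s 0 * reciprocal (plusTransform (α : ℂ) s) j) (rightShift (α : ℂ) s)
      (fun j => reciprocal (plusTransform (α : ℂ) s) j * s 0) j k =
    schurStieltjes (α : ℂ) s (j + k) := by
  have hu := h.isReduced_plusTransform α
  set u := plusTransform (α : ℂ) s
  have hu0 : u 0 = s 0 := rfl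
  set r := reciprocal u with hr
  have hv : ∀ j, rightShift (α : ℂ) s j = u (j + 1) := fun _ => rfl
  have e1 : ∀ k, ∑ p ∈ antidiagonal k, u (p.2 + 1) * r p.1 = -(s 0 * r (k + 1)) := by
    intro k
    have := hu.sum_mul_reciprocal (k + 1)
    rw [Finset.Nat.sum_antidiagonal_succ', if_neg (by omega)] at this
    exact (neg_eq_of_add_eq_zero_right this).symm
  have e2 : ∀ k, ∑ p ∈ antidiagonal k, r p.1 * u (p.2 + 1) = -(r (k + 1) * s 0) := by
    intro k
    have := hu.sum_reciprocal_mul (k + 1)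
    rw [Finset.Nat.sum_antidiagonal_succ', if_neg (by omega)] at this
    exact (neg_eq_of_add_eq_zero_right this).symm
  have e1' : ∀ k, ∑ p ∈ antidiagonal k, rightShift (α : ℂ) s p.2 * (r p.1 * s 0) =
      -(s 0 * r (k + 1) * s 0) := by
    intro k
    simp only [hv, ← Matrix.mul_assoc, ← Finset.sum_mul, e1, Matrix.neg_mul]
  have e2' : ∀ k, ∑ p ∈ antidiagonal k, s 0 * r p.1 * rightShift (α : ℂ) s p.2 =
      -(s 0 * r (k + 1) * s 0) := by
    intro k
    simp only [hv, Matrix.mul_assoc, ← Finset.mul_sum, e2, Matrix.mul_neg]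
  induction j generalizing k with
  | zero =>
    rw [hankelConv, Finset.Nat.antidiagonal_zero, Finset.sum_singleton, schurStieltjes_apply]
    simp only [Nat.zero_add, Matrix.mul_assoc, ← Finset.mul_sum]
    have := e1' k
    rw [this, hr, reciprocal_zero, hu0, ← hr, Matrix.mul_neg, Matrix.mul_neg,
      ← Matrix.mul_assoc, ← Matrix.mul_assoc, ← Matrix.mul_assoc,
      (isMoorePenrose_mpInv (s 0)).mul_mul_self, Matrix.mul_assoc]
  | succ j ih =>
    have := hankelConv_succ_left (fun j => s 0 * r j) (rightShift (α : ℂ) s)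
      (fun j => r j * s 0) j k
    rw [ih, e1', e2'] at this
    rw [show j + 1 + k = j + (k + 1) by omega, ← sub_eq_zero, this]
    simp only [Matrix.mul_neg, Matrix.neg_mul, Matrix.mul_assoc, sub_self]

/-- The scalar factor 1 - az can be moved from one factor of a Cauchy product to the other. -/
theorem plusTransform_mul_mk (a : ℂ) (f g : ℕ → Matrix (Fin q) (Fin q) ℂ) (n : ℕ) :
    ∑ p ∈ antidiagonal n, f p.2 * plusTransform a g p.1 =
      ∑ p ∈ antidiagonal n, plusTransform a f p.2 * g p.1 := by
  cases n with
  | zero => simp [plusTransform]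
  | succ n =>
    rw [Finset.Nat.sum_antidiagonal_succ, Finset.Nat.sum_antidiagonal_succ']
    simp only [plusTransform, Matrix.mul_add, Matrix.add_mul, Finset.sum_add_distrib,
      Matrix.mul_neg, Matrix.neg_mul, Matrix.mul_smul, Matrix.smul_mul]
    have h1 := Finset.Nat.sum_antidiagonal_succ (n := n) (f := fun p => f p.2 * g p.1)
    have h2 := Finset.Nat.sum_antidiagonal_succ' (n := n) (f := fun p => f p.2 * g p.1)
    rw [h1] at h2
    rw [add_left_comm, h2]
    abel

theorem plusTransform_isHermitian (h : ∀ j, (s j).IsHermitian) (j : ℕ) :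
    (plusTransform (α : ℂ) s j).IsHermitian := by
  cases j with
  | zero => exact h 0
  | succ j => exact isHermitian_shift α (h j) (h (j + 1))

theorem rightShift_schurStieltjes (a : ℂ) (j : ℕ) : rightShift a (schurStieltjes a s) j =
    -(s 0 * plusTransform a (reciprocal (plusTransform a s)) (j + 2) * s 0) := by
  simp only [rightShift, schurStieltjes_apply, plusTransform, Matrix.mul_add, Matrix.add_mul,
    Matrix.mul_neg, Matrix.neg_mul, Matrix.mul_smul, Matrix.smul_mul, smul_neg]
  abel

section

variable (h : IsReduced s)
include h

/-- Moving 1 - αz onto s turns the product into u r s_0 = P s_0 = s_0. -/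
theorem sum_mul_plusTransform_reciprocal (k : ℕ) :
    ∑ p ∈ antidiagonal k,
      s p.2 * (plusTransform (α : ℂ) (reciprocal (plusTransform (α : ℂ) s)) p.1 * s 0) =
      if k = 0 then s 0 else 0 := by
  have := plusTransform_mul_mk (α : ℂ) s (reciprocal (plusTransform (α : ℂ) s)) k
  rw [(h.isReduced_plusTransform α).sum_mul_reciprocal] at this
  simp only [← Matrix.mul_assoc, ← Finset.sum_mul, this, ite_mul, Matrix.zero_mul]
  congr 1
  exact (isMoorePenrose_mpInv (s 0)).mul_mul_self

theorem sum_plusTransform_reciprocal_mul (k : ℕ) :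
    ∑ p ∈ antidiagonal k,
      s 0 * plusTransform (α : ℂ) (reciprocal (plusTransform (α : ℂ) s)) p.1 * s p.2 =
      if k = 0 then s 0 else 0 := by
  have := congrArg conjTranspose (sum_mul_plusTransform_reciprocal α h k)
  simp only [conjTranspose_sum, conjTranspose_mul, (h.isHermitian _).eq, (plusTransform_isHermitian
    α (h.isReduced_plusTransform α).reciprocal_isHermitian _).eq] at this
  rw [this]
  split_ifs
  · exact h.isHermitian 0
  · exact conjTranspose_zero

theorem hankelConv_zero_left (k : ℕ) :
    hankelConv (fun j => s 0 * plusTransform (α : ℂ) (reciprocal (plusTransform (α : ℂ) s)) j) s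
      (fun j => plusTransform (α : ℂ) (reciprocal (plusTransform (α : ℂ) s)) j * s 0) 0 k =
    if k = 0 then s 0 else 0 := by
  rw [hankelConv, Finset.Nat.antidiagonal_zero, Finset.sum_singleton]
  simp only [Nat.zero_add, Matrix.mul_assoc, ← Finset.mul_sum]
  rw [sum_mul_plusTransform_reciprocal α h k, plusTransform, reciprocal_zero]
  split_ifs
  · rw [← Matrix.mul_assoc]
    exact (isMoorePenrose_mpInv (s 0)).mul_mul_self
  · rw [Matrix.mul_zero, Matrix.mul_zero]

/-- The boundary sums of the displacement identity vanish except at index 0. Hence the first row and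
column split off s_0, and what remains is Hankel; the index k - 1 accounts for the removed column.
-/
theorem hankelConv_succ (j k : ℕ) :
    hankelConv (fun j => s 0 * plusTransform (α : ℂ) (reciprocal (plusTransform (α : ℂ) s)) j) s
      (fun j => plusTransform (α : ℂ) (reciprocal (plusTransform (α : ℂ) s)) j * s 0)
      (j + 1) k =
    if k = 0 then 0 else rightShift (α : ℂ) (schurStieltjes (α : ℂ) s) (j + (k - 1)) := by
  induction j generalizing k with
  | zero =>
    have := hankelConv_succ_left
      (fun j => s 0 * plusTransform (α : ℂ) (reciprocal (plusTransform (α : ℂ) s)) j) s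
      (fun j => plusTransform (α : ℂ) (reciprocal (plusTransform (α : ℂ) s)) j * s 0) 0 k
    rw [hankelConv_zero_left α h, sum_mul_plusTransform_reciprocal α h,
      sum_plusTransform_reciprocal_mul α h, if_neg (by omega), sub_zero, if_pos rfl] at this
    rw [this]
    cases k with
    | zero => simp [Matrix.mul_assoc]
    | succ k =>
      rw [if_neg (by omega), if_neg (by omega), rightShift_schurStieltjes]
      simp [Matrix.mul_assoc]
  | succ j ih =>
    have := hankelConv_succ_left
      (fun j => s 0 * plusTransform (α : ℂ) (reciprocal (plusTransform (α : ℂ) s)) j) s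
      (fun j => plusTransform (α : ℂ) (reciprocal (plusTransform (α : ℂ) s)) j * s 0) (j + 1) k
    rw [ih, sum_mul_plusTransform_reciprocal α h,
      sum_plusTransform_reciprocal_mul α h, if_neg (Nat.succ_ne_zero k),
      if_neg (Nat.succ_ne_zero j), Matrix.zero_mul,
      sub_zero] at this
    rw [sub_eq_iff_eq_add.1 this]
    cases k with
    | zero =>
      simp only [if_pos, Nat.add_sub_cancel, rightShift_schurStieltjes]
      simp
    | succ k =>
      rw [if_neg (by omega), if_neg (by omega), Matrix.mul_zero, zero_add]
      congr 1
      omega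

end

end Reduced

/-! ### Congruence by unit triangular Toeplitz matrices -/

section Congruence

variable {q N n : ℕ}

theorem isUnit_comp_lowerToeplitz {f : ℕ → Matrix (Fin q) (Fin q) ℂ} (hf : f 0 = 1) (n : ℕ) :
    IsUnit (comp _ _ _ _ _ (lowerToeplitz f n)) := by
  obtain ⟨g, -, hg⟩ := exists_lowerToeplitz_inverse f hf
  exact (isUnit_comp_iff _ _ _).2 ⟨⟨_, _, (hg n).1, (hg n).2⟩, rfl⟩

/-- Congruence by a unit lower triangular Toeplitz matrix preserves the existence of a kernel
column whose last block is the identity. -/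
theorem exists_lowerToeplitz_mul_mul_mulVec_eq_zero {f : ℕ → Matrix (Fin q) (Fin q) ℂ}
    (hf : f 0 = 1) {M : Matrix (Fin (n + 1)) (Fin (n + 1)) (Matrix (Fin q) (Fin q) ℂ)}
    (h : ∃ x : Fin (n + 1) → Matrix (Fin q) (Fin q) ℂ, x (Fin.last n) = 1 ∧ M *ᵥ x = 0) :
    ∃ x : Fin (n + 1) → Matrix (Fin q) (Fin q) ℂ, x (Fin.last n) = 1 ∧
      (lowerToeplitz f n * M * (lowerToeplitz f n)ᴴ) *ᵥ x = 0 := by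
  obtain ⟨x, hx, h0⟩ := h
  obtain ⟨g, hg0, hg⟩ := exists_lowerToeplitz_inverse f hf
  -- The adjoint of the inverse is unit upper triangular, so the last block of x is unchanged.
  refine ⟨(lowerToeplitz g n)ᴴ *ᵥ x, ?_, ?_⟩
  · rw [mulVec, dotProduct, Finset.sum_eq_single (Fin.last n)]
    · simp [lowerToeplitz, conjTranspose_apply, hg0, hx]
    · intro b _ hb
      simp [lowerToeplitz, conjTranspose_apply, hb]
    · simp
  · rw [mulVec_mulVec, Matrix.mul_assoc, ← conjTranspose_mul, (hg n).2, conjTranspose_one,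
      Matrix.mul_one, ← mulVec_mulVec, h0, mulVec_zero]

end Congruence

/-! ### The theorem for reduced sequences -/

section ReducedTransform

variable {q n : ℕ} {s : ℕ → Matrix (Fin q) (Fin q) ℂ} (α : ℝ)

theorem IsReduced.hankel_schurStieltjes (h : IsReduced s) (n : ℕ) :
    hankel (schurStieltjes (α : ℂ) s) n =
      lowerToeplitz (unitSeq (s 0) (reciprocal (plusTransform (α : ℂ) s))) n *
        hankel (rightShift (α : ℂ) s) n *
        (lowerToeplitz (unitSeq (s 0) (reciprocal (plusTransform (α : ℂ) s))) n)ᴴ := by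
  have hu := h.isReduced_plusTransform α
  refine Matrix.ext fun j k => ?_
  rw [lowerToeplitz_mul_hankel_mul,
    hankelConv_unitSeq (v := rightShift (α : ℂ) s) (h.isHermitian 0)
      hu.reciprocal_isHermitian reciprocal_zero (fun j => hu.proj_mul (j + 1))
    (fun j => hu.mul_proj (j + 1)), hankelConv_rightShift α h]
  rfl

theorem IsReduced.lowerToeplitz_mul_hankel_mul_apply_succ (h : IsReduced s) (n : ℕ)
    (j : Fin (n + 1)) (k : Fin (n + 2)) :
    (lowerToeplitz (unitSeq (s 0) (plusTransform (α : ℂ)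
        (reciprocal (plusTransform (α : ℂ) s)))) (n + 1) * hankel s (n + 1) *
      (lowerToeplitz (unitSeq (s 0) (plusTransform (α : ℂ)
        (reciprocal (plusTransform (α : ℂ) s)))) (n + 1))ᴴ) j.succ k =
      if (k : ℕ) = 0 then 0 else rightShift (α : ℂ) (schurStieltjes (α : ℂ) s) (j + (k - 1)) := by
  rw [lowerToeplitz_mul_hankel_mul, hankelConv_unitSeq (h.isHermitian 0)
    (plusTransform_isHermitian α (h.isReduced_plusTransform α).reciprocal_isHermitian)
    reciprocal_zero h.proj_mul h.mul_proj, Fin.val_succ, hankelConv_succ α h]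

theorem IsReduced.blockHankel_rightShift_schurStieltjes (h : IsReduced s) (n : ℕ) :
    blockHankel (rightShift (α : ℂ) (schurStieltjes (α : ℂ) s)) n =
      (comp _ _ _ _ _ (lowerToeplitz (unitSeq (s 0) (plusTransform (α : ℂ)
        (reciprocal (plusTransform (α : ℂ) s)))) (n + 1)) * blockHankel s (n + 1) *
      (comp _ _ _ _ _ (lowerToeplitz (unitSeq (s 0) (plusTransform (α : ℂ)
        (reciprocal (plusTransform (α : ℂ) s)))) (n + 1)))ᴴ).submatrix
        (Prod.map Fin.succ id) (Prod.map Fin.succ id) := by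
  rw [blockHankel_eq_comp (s := s), ← comp_mul_mul_conjTranspose]
  ext a b
  rw [submatrix_apply, comp_apply]
  simp only [Prod.map_fst, Prod.map_snd, id_eq]
  rw [h.lowerToeplitz_mul_hankel_mul_apply_succ α n, if_neg (by simp)]
  simp [blockHankel]

theorem IsReduced.schurStieltjes_mem_HNonneg (h : IsReduced s)
    (hs : rightShift (α : ℂ) s ∈ HNonneg q n) : schurStieltjes (α : ℂ) s ∈ HNonneg q n := by
  change (blockHankel _ _).PosSemidef
  rw [blockHankel_eq_comp, h.hankel_schurStieltjes α, comp_mul_mul_conjTranspose]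
  exact PosSemidef.mul_mul_conjTranspose_same hs _

theorem IsReduced.schurStieltjes_mem_HPos (h : IsReduced s)
    (hs : rightShift (α : ℂ) s ∈ HPos q n) : schurStieltjes (α : ℂ) s ∈ HPos q n := by
  change (blockHankel _ _).PosDef
  rw [blockHankel_eq_comp, h.hankel_schurStieltjes α, comp_mul_mul_conjTranspose]
  exact (IsUnit.posDef_star_right_conjugate_iff (isUnit_comp_lowerToeplitz rfl n)).2 hs

theorem IsReduced.schurStieltjes_mem_HNonnegCD (h : IsReduced s)
    (hs : rightShift (α : ℂ) s ∈ HNonnegCD q n) : schurStieltjes (α : ℂ) s ∈ HNonnegCD q n := by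
  have hn := h.schurStieltjes_mem_HNonneg α hs.1
  refine ⟨hn, (hankelSchur_eq_zero_iff hn).2 ?_⟩
  rw [h.hankel_schurStieltjes α]
  exact exists_lowerToeplitz_mul_mul_mulVec_eq_zero rfl ((hankelSchur_eq_zero_iff hs.1).1 hs.2)

theorem IsReduced.rightShift_schurStieltjes_mem_HNonneg (h : IsReduced s)
    (hs : s ∈ HNonneg q (n + 1)) :
    rightShift (α : ℂ) (schurStieltjes (α : ℂ) s) ∈ HNonneg q n := by
  change (blockHankel _ _).PosSemidef
  rw [h.blockHankel_rightShift_schurStieltjes α]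
  exact (PosSemidef.mul_mul_conjTranspose_same hs _).submatrix _

theorem IsReduced.rightShift_schurStieltjes_mem_HPos (h : IsReduced s)
    (hs : s ∈ HPos q (n + 1)) :
    rightShift (α : ℂ) (schurStieltjes (α : ℂ) s) ∈ HPos q n := by
  change (blockHankel _ _).PosDef
  rw [h.blockHankel_rightShift_schurStieltjes α]
  exact ((IsUnit.posDef_star_right_conjugate_iff (isUnit_comp_lowerToeplitz rfl (n + 1))).2
    hs).submatrix ((Fin.succ_injective _).prodMap Function.injective_id)

theorem IsReduced.rightShift_schurStieltjes_mem_HNonnegCD (h : IsReduced s)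
    (hs : s ∈ HNonnegCD q (n + 1)) :
    rightShift (α : ℂ) (schurStieltjes (α : ℂ) s) ∈ HNonnegCD q n := by
  have hn := h.rightShift_schurStieltjes_mem_HNonneg α hs.1
  refine ⟨hn, (hankelSchur_eq_zero_iff hn).2 ?_⟩
  obtain ⟨x, hx, h0⟩ := exists_lowerToeplitz_mul_mul_mulVec_eq_zero
    (f := unitSeq (s 0) (plusTransform (α : ℂ) (reciprocal (plusTransform (α : ℂ) s)))) rfl
    ((hankelSchur_eq_zero_iff hs.1).1 hs.2)
  -- Below the first row the congruent matrix has zero first column, so the first block of x can be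
  -- dropped.
  refine ⟨fun k => x k.succ, hx, ?_⟩
  ext1 j
  have := congrFun h0 j.succ
  simp only [mulVec, dotProduct] at this
  rw [Fin.sum_univ_succ, h.lowerToeplitz_mul_hankel_mul_apply_succ α n j 0, if_pos (by simp),
    Matrix.zero_mul, zero_add] at this
  rw [mulVec, dotProduct]
  refine Eq.trans (Finset.sum_congr rfl fun k _ => ?_) this
  rw [h.lowerToeplitz_mul_hankel_mul_apply_succ α n j k.succ, if_neg (by simp)]
  simp [hankel]

theorem IsReduced.schurStieltjes_mem_KNonnegFin (h : IsReduced s) {m : ℕ}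
    (hs : s ∈ KNonnegFin q α (m + 1)) : schurStieltjes (α : ℂ) s ∈ KNonnegFin q α m := by
  refine ⟨h.schurStieltjes_mem_HNonneg α (hs.2 (by omega)), fun hm => ?_⟩
  apply h.rightShift_schurStieltjes_mem_HNonneg α
  rw [show (m - 1) / 2 + 1 = (m + 1) / 2 by omega]
  exact hs.1

theorem IsReduced.schurStieltjes_mem_KPosFin (h : IsReduced s) {m : ℕ}
    (hs : s ∈ KPosFin q α (m + 1)) : schurStieltjes (α : ℂ) s ∈ KPosFin q α m := by
  refine ⟨h.schurStieltjes_mem_HPos α (hs.2 (by omega)), fun hm => ?_⟩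
  apply h.rightShift_schurStieltjes_mem_HPos α
  rw [show (m - 1) / 2 + 1 = (m + 1) / 2 by omega]
  exact hs.1

theorem IsReduced.schurStieltjes_mem_KNonnegCDFin (h : IsReduced s) {m : ℕ}
    (hs : s ∈ KNonnegCDFin q α (m + 1)) : schurStieltjes (α : ℂ) s ∈ KNonnegCDFin q α m := by
  refine ⟨h.schurStieltjes_mem_KNonnegFin α hs.1, fun n hn => ?_, fun n hn => ?_⟩
  · exact h.schurStieltjes_mem_HNonnegCD α (hs.2.2 n (by omega))
  · exact h.rightShift_schurStieltjes_mem_HNonnegCD α (hs.2.1 (n + 1) (by omega))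

end ReducedTransform

/-! ### The classes depend on finitely many terms -/

section Locality

variable {q m n : ℕ} {s s' : ℕ → Matrix (Fin q) (Fin q) ℂ}

theorem rightShift_congr (a : ℂ) (h : ∀ j ≤ m + 1, s j = s' j) :
    ∀ j ≤ m, rightShift a s j = rightShift a s' j := fun j hj => by
  rw [rightShift, rightShift, h j (by omega), h (j + 1) (by omega)]

theorem HNonneg_congr (h : ∀ j ≤ 2 * n, s j = s' j) (hs : s ∈ HNonneg q n) :
    s' ∈ HNonneg q n := by
  change (blockHankel s' n).PosSemidef
  rw [← blockHankel_congr h]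
  exact hs

theorem HPos_congr (h : ∀ j ≤ 2 * n, s j = s' j) (hs : s ∈ HPos q n) : s' ∈ HPos q n := by
  change (blockHankel s' n).PosDef
  rw [← blockHankel_congr h]
  exact hs

theorem HNonnegCD_congr (h : ∀ j ≤ 2 * n, s j = s' j) (hs : s ∈ HNonnegCD q n) :
    s' ∈ HNonnegCD q n := by
  have hn := HNonneg_congr h hs.1
  refine ⟨hn, (hankelSchur_eq_zero_iff hn).2 ?_⟩
  rw [← hankel_congr h]
  exact (hankelSchur_eq_zero_iff hs.1).1 hs.2

variable {α : ℝ}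

theorem KNonnegFin_congr (h : ∀ j ≤ m, s j = s' j) (hs : s ∈ KNonnegFin q α m) :
    s' ∈ KNonnegFin q α m :=
  ⟨HNonneg_congr (fun j hj => h j (by omega)) hs.1, fun hm => HNonneg_congr
    (fun j hj => rightShift_congr (m := m - 1) _ (fun i hi => h i (by omega)) j (by omega))
    (hs.2 hm)⟩

theorem KPosFin_congr (h : ∀ j ≤ m, s j = s' j) (hs : s ∈ KPosFin q α m) :
    s' ∈ KPosFin q α m :=
  ⟨HPos_congr (fun j hj => h j (by omega)) hs.1, fun hm => HPos_congr
    (fun j hj => rightShift_congr (m := m - 1) _ (fun i hi => h i (by omega)) j (by omega))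
    (hs.2 hm)⟩

theorem KNonnegCDFin_congr (h : ∀ j ≤ m, s j = s' j) (hs : s ∈ KNonnegCDFin q α m) :
    s' ∈ KNonnegCDFin q α m :=
  ⟨KNonnegFin_congr h hs.1,
    fun n hn => HNonnegCD_congr (fun j hj => h j (by omega)) (hs.2.1 n hn),
    fun n hn => HNonnegCD_congr (fun j hj =>
      rightShift_congr (m := 2 * n) _ (fun i hi => h i (by omega)) j hj) (hs.2.2 n hn)⟩

end Locality

/-! ### Reduction to reduced sequences by compression -/

section Reduction

variable {q m n : ℕ} {s s' : ℕ → Matrix (Fin q) (Fin q) ℂ} {α : ℝ}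

/-- The sequence compressed to the range of its initial term and truncated after index `m`. -/
noncomputable def compress (s : ℕ → Matrix (Fin q) (Fin q) ℂ) (m : ℕ) :
    ℕ → Matrix (Fin q) (Fin q) ℂ :=
  fun j => if j ≤ m then s 0 * mpInv (s 0) * s j * (s 0 * mpInv (s 0)) else 0

theorem compress_zero (h : (s 0).IsHermitian) : compress s m 0 = s 0 := by
  rw [compress, if_pos (Nat.zero_le _), (isMoorePenrose_mpInv (s 0)).mul_mul_self,
    mul_mul_mpInv h]

theorem proj_mul_proj (A : Matrix (Fin q) (Fin q) ℂ) :
    A * mpInv A * (A * mpInv A) = A * mpInv A := by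
  rw [← Matrix.mul_assoc, (isMoorePenrose_mpInv A).mul_mul_self]

theorem isReduced_compress (h : ∀ j ≤ m, (s j).IsHermitian) : IsReduced (compress s m) where
  isHermitian j := by
    have hP := (isMoorePenrose_mpInv (s 0)).isHermitian_left
    rw [compress]
    generalize s 0 * mpInv (s 0) = P at hP ⊢
    split_ifs with hj
    · rw [IsHermitian, conjTranspose_mul, conjTranspose_mul, hP.eq, (h j hj).eq, Matrix.mul_assoc]
    · exact isHermitian_zero
  proj_mul j := by
    have hP := proj_mul_proj (s 0)
    rw [compress_zero (h 0 (Nat.zero_le _)), compress]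
    generalize s 0 * mpInv (s 0) = P at hP ⊢
    split_ifs
    · rw [← Matrix.mul_assoc, ← Matrix.mul_assoc, hP]
    · rw [Matrix.mul_zero]

theorem schurStieltjes_congr (a : ℂ) (h : (s 0).IsHermitian)
    (hs : ∀ j ≤ m + 1, s' j = s 0 * mpInv (s 0) * s j * (s 0 * mpInv (s 0))) :
    ∀ j ≤ m, schurStieltjes a s' j = schurStieltjes a s j := by
  intro j hj
  have h0 : s' 0 = s 0 := by
    rw [hs 0 (by omega), (isMoorePenrose_mpInv (s 0)).mul_mul_self, mul_mul_mpInv h]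
  rw [schurStieltjes_apply, schurStieltjes_apply, h0,
    reciprocal_congr (u := plusTransform a s) (w := plusTransform a s') h (m := m + 1)
      h0 ?_ (j + 1) (by omega)]
  intro i hi
  cases i with
  | zero => exact hs 0 (by omega)
  | succ i =>
    change -(a • s' i) + s' (i + 1) =
      s 0 * mpInv (s 0) * (-(a • s i) + s (i + 1)) * (s 0 * mpInv (s 0))
    rw [hs i (by omega), hs (i + 1) hi]
    simp only [Matrix.mul_add, Matrix.add_mul, Matrix.mul_neg, Matrix.neg_mul, Matrix.mul_smul,
      Matrix.smul_mul]

theorem schurStieltjes_compress (a : ℂ) (h : (s 0).IsHermitian) :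
    ∀ j ≤ m, schurStieltjes a (compress s (m + 1)) j = schurStieltjes a s j :=
  schurStieltjes_congr a h fun _ hj => if_pos hj

theorem schurStieltjes_congr_of_eq (a : ℂ) (h : (s 0).IsHermitian)
    (hs : ∀ j ≤ m + 1, s' j = s j) :
    ∀ j ≤ m, schurStieltjes a s' j = schurStieltjes a s j := by
  intro j hj
  have e : compress s' (m + 1) = compress s (m + 1) := by
    funext i
    simp only [compress, hs 0 (by omega)]
    split_ifs with hi
    · rw [hs i hi]
    · rfl
  rw [← schurStieltjes_compress a h j hj,
    ← schurStieltjes_compress a (s := s') (by rwa [hs 0 (by omega)]) j hj, e]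

theorem HNonneg_of_compression {P : Matrix (Fin q) (Fin q) ℂ} (hP : P.IsHermitian)
    (h : ∀ j ≤ 2 * n, s' j = P * s j * P) (hs : s ∈ HNonneg q n) : s' ∈ HNonneg q n := by
  have e : hankel s' n = diagonal (fun _ => P) * hankel s n * (diagonal fun _ => P)ᴴ := by
    rw [diagonal_conjTranspose]
    refine Matrix.ext fun j k => ?_
    rw [mul_diagonal, diagonal_mul]
    change s' (j + k) = P * s (j + k) * Pᴴ
    rw [hP.eq, h _ (by have := j.isLt; have := k.isLt; omega)]
  change (blockHankel _ _).PosSemidef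
  rw [blockHankel_eq_comp, e, comp_mul_mul_conjTranspose]
  exact PosSemidef.mul_mul_conjTranspose_same hs _

/-- Only the corner s_{2n} changes; the subtracted term is built from blocks already fixed by P on
both sides. -/
theorem hankelSchur_compression {P : Matrix (Fin q) (Fin q) ℂ}
    (h : ∀ j < 2 * n, s' j = s j) (hl : ∀ j < 2 * n, P * s j = s j)
    (hr : ∀ j < 2 * n, s j * P = s j) (h2 : s' (2 * n) = P * s (2 * n) * P) :
    hankelSchur s' n = P * hankelSchur s n * P := by
  cases n with
  | zero => exact h2
  | succ n =>
    have e1 : blockHankel s' n = blockHankel s n := blockHankel_congr fun j hj => h j (by omega)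
    have e2 : blockRow s' (n + 1) n = blockRow s (n + 1) n := by
      ext a b
      simp only [blockRow, Matrix.of_apply]
      rw [h _ (by have := b.1.isLt; omega)]
    have e3 : blockCol s' (n + 1) n = blockCol s (n + 1) n := by
      ext a b
      simp only [blockCol, Matrix.of_apply]
      rw [h _ (by have := a.1.isLt; omega)]
    have e4 : P * blockRow s (n + 1) n = blockRow s (n + 1) n := by
      ext a b
      exact congrFun (congrFun (hl (n + 1 + b.1) (by have := b.1.isLt; omega)) a) b.2
    have e5 : blockCol s (n + 1) n * P = blockCol s (n + 1) n := by
      ext a b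
      exact congrFun (congrFun (hr (n + 1 + a.1) (by have := a.1.isLt; omega)) a.2) b
    have e6 : P * (blockRow s (n + 1) n * mpInv (blockHankel s n) * blockCol s (n + 1) n) * P =
        blockRow s (n + 1) n * mpInv (blockHankel s n) * blockCol s (n + 1) n := by
      rw [Matrix.mul_assoc, Matrix.mul_assoc _ _ P, e5, ← Matrix.mul_assoc, ← Matrix.mul_assoc, e4]
    rw [hankelSchur, hankelSchur, e1, e2, e3, h2, Matrix.mul_sub, Matrix.sub_mul, e6]

theorem isHermitian_of_mem_KNonnegFin (hs : s ∈ KNonnegFin q α m) :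
    ∀ j ≤ m, (s j).IsHermitian := by
  intro j hj
  by_cases h : j ≤ 2 * (m / 2)
  · exact isHermitian_of_blockHankel hs.1.isHermitian h
  · obtain ⟨i, rfl⟩ : ∃ i, j = i + 1 := ⟨j - 1, by omega⟩
    have h1 : (s i).IsHermitian := isHermitian_of_blockHankel hs.1.isHermitian (by omega)
    have h2 : (rightShift (α : ℂ) s i).IsHermitian :=
      isHermitian_of_blockHankel (hs.2 (by omega)).isHermitian (by omega)
    have h3 : s (i + 1) = (α : ℂ) • s i + rightShift (α : ℂ) s i := by
      rw [rightShift]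
      abel
    rw [h3, IsHermitian, conjTranspose_add, conjTranspose_smul, h1.eq, h2.eq]
    simp

/-- The matrix H yields all indices below 2⌊m/2⌋. For odd m the index m - 1 is missing, and the
shifted Hankel matrix supplies it. -/
theorem mul_eq_zero_of_mem_KNonnegFin (hs : s ∈ KNonnegFin q α m)
    {E : Matrix (Fin q) (Fin q) ℂ} (hE : s 0 * E = 0) : ∀ j < m, s j * E = 0 := by
  intro j hj
  have h1 := mul_eq_zero_of_zero hs.1 hE
  rcases Nat.eq_zero_or_pos j with rfl | hj0
  · exact hE
  by_cases h : j < 2 * (m / 2)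
  · exact h1 j h
  · obtain ⟨i, rfl⟩ : ∃ i, j = i + 1 := ⟨j - 1, by omega⟩
    have h0 : rightShift (α : ℂ) s 0 * E = 0 := by
      rw [rightShift, Matrix.add_mul, Matrix.neg_mul, Matrix.smul_mul, hE, h1 _ (by omega)]
      simp
    have h2 := mul_eq_zero_of_zero (hs.2 (by omega)) h0 i (by omega)
    rw [rightShift, Matrix.add_mul, Matrix.neg_mul, Matrix.smul_mul, h1 i (by omega)] at h2
    simpa using h2

theorem mul_proj_of_mem_KNonnegFin (hs : s ∈ KNonnegFin q α m) {j : ℕ} (hj : j < m) :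
    s j * (s 0 * mpInv (s 0)) = s j := by
  have h0 := isHermitian_of_mem_KNonnegFin hs 0 (Nat.zero_le _)
  -- This E is the orthogonal projection onto the kernel of s_0.
  have := mul_eq_zero_of_mem_KNonnegFin hs (E := 1 - s 0 * mpInv (s 0))
    (by rw [Matrix.mul_sub, Matrix.mul_one, mul_mul_mpInv h0, sub_self]) j hj
  rw [Matrix.mul_sub, Matrix.mul_one, sub_eq_zero] at this
  exact this.symm

theorem proj_mul_of_mem_KNonnegFin (hs : s ∈ KNonnegFin q α m) {j : ℕ} (hj : j < m) :
    s 0 * mpInv (s 0) * s j = s j := by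
  have h := congrArg conjTranspose (mul_proj_of_mem_KNonnegFin hs hj)
  rwa [conjTranspose_mul, (isMoorePenrose_mpInv (s 0)).isHermitian_left,
    (isHermitian_of_mem_KNonnegFin hs j hj.le).eq] at h

theorem rightShift_compress (a : ℂ) {j : ℕ} (hj : j + 1 ≤ m) : rightShift a (compress s m) j =
    s 0 * mpInv (s 0) * rightShift a s j * (s 0 * mpInv (s 0)) := by
  rw [rightShift, rightShift, compress, compress, if_pos hj, if_pos (by omega)]
  simp only [Matrix.mul_add, Matrix.add_mul, Matrix.mul_neg, Matrix.neg_mul, Matrix.mul_smul,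
    Matrix.smul_mul]

theorem compress_mem_KNonnegFin (hs : s ∈ KNonnegFin q α m) :
    compress s m ∈ KNonnegFin q α m := by
  have hP := (isMoorePenrose_mpInv (s 0)).isHermitian_left
  exact ⟨HNonneg_of_compression hP (fun j hj => if_pos (by omega)) hs.1, fun hm =>
    HNonneg_of_compression hP (fun j hj => rightShift_compress _ (by omega)) (hs.2 hm)⟩

theorem compress_of_lt (hs : s ∈ KNonnegFin q α m) {j : ℕ} (hj : j < m) :
    compress s m j = s j := by
  rw [compress, if_pos hj.le, proj_mul_of_mem_KNonnegFin hs hj, mul_proj_of_mem_KNonnegFin hs hj]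

theorem compress_mem_KNonnegCDFin (hs : s ∈ KNonnegCDFin q α m) :
    compress s m ∈ KNonnegCDFin q α m := by
  have hc := compress_mem_KNonnegFin hs.1
  refine ⟨hc, fun n hn => ?_, fun n hn => ?_⟩
  · subst hn
    refine ⟨by simpa using hc.1, ?_⟩
    rw [hankelSchur_compression (s := s) (P := s 0 * mpInv (s 0))
      (fun j hj => compress_of_lt hs.1 hj)
      (fun j hj => proj_mul_of_mem_KNonnegFin hs.1 hj)
      (fun j hj => mul_proj_of_mem_KNonnegFin hs.1 hj) (if_pos le_rfl), (hs.2.1 n rfl).2,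
      Matrix.mul_zero, Matrix.zero_mul]
  · subst hn
    refine ⟨by simpa using hc.2 (by omega), ?_⟩
    have hl : ∀ j < 2 * n, s 0 * mpInv (s 0) * rightShift (α : ℂ) s j =
        rightShift (α : ℂ) s j := fun j hj => by
      rw [rightShift, Matrix.mul_add, Matrix.mul_neg, Matrix.mul_smul,
        proj_mul_of_mem_KNonnegFin hs.1 (by omega), proj_mul_of_mem_KNonnegFin hs.1 (by omega)]
    have hr : ∀ j < 2 * n, rightShift (α : ℂ) s j * (s 0 * mpInv (s 0)) =
        rightShift (α : ℂ) s j := fun j hj => by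
      rw [rightShift, Matrix.add_mul, Matrix.neg_mul, Matrix.smul_mul,
        mul_proj_of_mem_KNonnegFin hs.1 (by omega), mul_proj_of_mem_KNonnegFin hs.1 (by omega)]
    rw [hankelSchur_compression (s := rightShift (α : ℂ) s) (P := s 0 * mpInv (s 0))
      (fun j hj => by rw [rightShift_compress _ (by omega), hl j hj, hr j hj]) hl hr
      (rightShift_compress _ le_rfl), (hs.2.2 n rfl).2, Matrix.mul_zero, Matrix.zero_mul]

theorem KPosFin_subset_KNonnegFin : KPosFin q α m ⊆ KNonnegFin q α m :=
  fun _ hs => ⟨hs.1.posSemidef, fun hm => (hs.2 hm).posSemidef⟩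

theorem mul_mpInv_of_mem_KPosFin (hs : s ∈ KPosFin q α m) : s 0 * mpInv (s 0) = 1 := by
  have h0 : (s 0).PosDef := by
    have := PosDef.submatrix hs.1 (e := fun i => (0, i)) (Prod.mk_right_injective 0)
    exact this
  have hu := h0.isUnit
  exact hu.mul_right_cancel (by rw [(isMoorePenrose_mpInv (s 0)).mul_mul_self, Matrix.one_mul])

/-- Here s_0 is invertible, so P = 1 and compression changes nothing up to index m. -/
theorem compress_mem_KPosFin (hs : s ∈ KPosFin q α m) : compress s m ∈ KPosFin q α m := by
  refine KPosFin_congr (fun j hj => ?_) hs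
  rw [compress, if_pos hj, mul_mpInv_of_mem_KPosFin hs, Matrix.one_mul, Matrix.mul_one]

theorem schurStieltjes_mem_KNonnegFin (hs : s ∈ KNonnegFin q α (m + 1)) :
    schurStieltjes (α : ℂ) s ∈ KNonnegFin q α m := by
  have hh := isHermitian_of_mem_KNonnegFin hs
  exact KNonnegFin_congr (schurStieltjes_compress _ (hh 0 (Nat.zero_le _)))
    ((isReduced_compress hh).schurStieltjes_mem_KNonnegFin α (compress_mem_KNonnegFin hs))

theorem schurStieltjes_mem_KPosFin (hs : s ∈ KPosFin q α (m + 1)) :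
    schurStieltjes (α : ℂ) s ∈ KPosFin q α m := by
  have hh := isHermitian_of_mem_KNonnegFin (KPosFin_subset_KNonnegFin hs)
  exact KPosFin_congr (schurStieltjes_compress _ (hh 0 (Nat.zero_le _)))
    ((isReduced_compress hh).schurStieltjes_mem_KPosFin α (compress_mem_KPosFin hs))

theorem schurStieltjes_mem_KNonnegCDFin (hs : s ∈ KNonnegCDFin q α (m + 1)) :
    schurStieltjes (α : ℂ) s ∈ KNonnegCDFin q α m := by
  have hh := isHermitian_of_mem_KNonnegFin hs.1
  exact KNonnegCDFin_congr (schurStieltjes_compress _ (hh 0 (Nat.zero_le _)))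
    ((isReduced_compress hh).schurStieltjes_mem_KNonnegCDFin α (compress_mem_KNonnegCDFin hs))

/-- Degeneracy at index 0 means s_0 = 0, which makes the transform zero; this is why the index stays
at 0 instead of dropping. -/
theorem schurStieltjes_mem_KNonnegCDFin_zero (hs : s ∈ KNonnegCDFin q α 0) :
    schurStieltjes (α : ℂ) s ∈ KNonnegCDFin q α 0 := by
  have h0 : s 0 = 0 := (hs.2.1 0 rfl).2
  refine KNonnegCDFin_congr (fun j hj => ?_) hs
  obtain rfl : j = 0 := by omega
  rw [schurStieltjes_apply, h0, Matrix.mul_zero, neg_zero]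

theorem schurStieltjes_mem_KNonnegCDFin_pred (hs : s ∈ KNonnegCDFin q α m) :
    schurStieltjes (α : ℂ) s ∈ KNonnegCDFin q α (m - 1) := by
  cases m with
  | zero => exact schurStieltjes_mem_KNonnegCDFin_zero hs
  | succ m => exact schurStieltjes_mem_KNonnegCDFin hs

end Reduction

end StieltjesSeq

/-! ### Assembly for infinite and finite length -/

open StieltjesSeq in
theorem theoremP1546 (q : ℕ) (hq : 1 ≤ q) (α : ℝ) (κ : ℕ∞) (hκ : 1 ≤ κ)
    (s : ℕ → Matrix (Fin q) (Fin q) ℂ) :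
    (s ∈ StieltjesSeq.KNonneg q α κ →
      StieltjesSeq.schurStieltjes (α : ℂ) s ∈ StieltjesSeq.KNonneg q α (κ - 1)) ∧
    (s ∈ StieltjesSeq.KNonnegExt q α κ →
      StieltjesSeq.schurStieltjes (α : ℂ) s ∈ StieltjesSeq.KNonnegExt q α (κ - 1)) ∧
    (s ∈ StieltjesSeq.KPos q α κ →
      StieltjesSeq.schurStieltjes (α : ℂ) s ∈ StieltjesSeq.KPos q α (κ - 1)) ∧
    (∀ m : ℕ, (m : ℕ∞) ≤ κ → s ∈ StieltjesSeq.KNonnegCDAt q α κ m →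
      StieltjesSeq.schurStieltjes (α : ℂ) s ∈
        StieltjesSeq.KNonnegCDAt q α (κ - 1) (max 0 (m - 1))) ∧
    (s ∈ StieltjesSeq.KNonnegCD q α κ →
      StieltjesSeq.schurStieltjes (α : ℂ) s ∈ StieltjesSeq.KNonnegCD q α (κ - 1)) := by
  induction κ using ENat.recTopCoe with
  | top =>
    have h1 : s ∈ KNonneg q α ⊤ → schurStieltjes (α : ℂ) s ∈ KNonneg q α ⊤ :=
      fun hs m => schurStieltjes_mem_KNonnegFin (hs (m + 1))
    refine ⟨h1, h1, fun hs m => schurStieltjes_mem_KPosFin (hs (m + 1)), fun m _ hs => ?_, ?_⟩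
    · rw [Nat.zero_max]
      exact ⟨h1 hs.1, schurStieltjes_mem_KNonnegCDFin_pred hs.2⟩
    · rintro ⟨hs, m, hm⟩
      exact ⟨h1 hs, m - 1, schurStieltjes_mem_KNonnegCDFin_pred hm⟩
  | coe κ =>
    obtain ⟨n, rfl⟩ : ∃ n, κ = n + 1 := ⟨κ - 1, (Nat.sub_add_cancel (by exact_mod_cast hκ)).symm⟩
    have e : ((n + 1 : ℕ) : ℕ∞) - 1 = (n : ℕ∞) := by norm_cast
    rw [e]
    have h1 : s ∈ KNonneg q α (n + 1 : ℕ) → schurStieltjes (α : ℂ) s ∈ KNonneg q α n :=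
      fun hs => schurStieltjes_mem_KNonnegFin hs
    refine ⟨h1, ?_, fun hs => schurStieltjes_mem_KPosFin hs, fun m _ hs => ?_,
      fun hs => schurStieltjes_mem_KNonnegCDFin hs⟩
    · rintro ⟨t, ht, hts⟩
      have ht0 := isHermitian_of_mem_KNonnegFin ht 0 (Nat.zero_le _)
      -- The transform of the extension t extends the transform of s, since t_j^{[1,α]} involves
      -- only terms up to index j + 1.
      exact ⟨schurStieltjes (α : ℂ) t, schurStieltjes_mem_KNonnegFin ht, fun j hj =>
        (schurStieltjes_congr_of_eq _ ht0 (fun i hi => (hts i hi).symm) j hj).symm⟩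
    · rw [Nat.zero_max]
      exact ⟨h1 hs.1, schurStieltjes_mem_KNonnegCDFin_pred hs.2⟩
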